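/- Let $k$ be a field. All coalgebras below are $k$-vector spaces with a $k$-linear coassociative comultiplication. A counital coalgebra $C$ over $k$ is \emph{pointed} if each of its cosimple subcoalgebras (nonzero subcoalgebras having no subcoalgebras other than $0$ and themselves) is one-dimensional; its \emph{coradical} $C_0$ is the sum of all its cosimple subcoalgebras. A \emph{pointed coalgebra with a splitting} is a pair $(C,\delta)$ of a pointed coalgebra $C$ and a coalgebra homomorphism $\delta\colon C\to C_0$ with $\delta|_{C_0}=\mathrm{id}$ (so $C=C_0\oplus\ker\delta$). A morphism $(C,\delta)\to(D,\mu)$ is a coalgebra homomorphism $f\colon C\to D$ with $\mu\circ f=f\circ\delta$ (the coradicals being regarded as subspaces). A \emph{reduced colored coalgebra} is a pair $(\overline C,G)$ consisting of a set $G$ and a coassociative coalgebra $(\overline C,\overline\Delta)$, not required to have a counit, with a decomposition $\overline C=\bigoplus_{g,h\in G}{}^g\overline C{}^h$ such that $\overline\Delta({}^g\overline C{}^h)\subseteq\bigoplus_{s\in G}{}^g\overline C{}^s\otimes{}^s\overline C{}^h$, and which is conilpotent: for every $x\in\overline C$ there is $n$ with $\overline\Delta{}^n(x)=0$, where $\overline\Delta{}^n\colon\overline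 C\to\overline C{}^{\otimes(n+1)}$ is the iterated comultiplication. A morphism $(\overline C,G)\to(\overline D,S)$ is a pair $(f,i)$ of a linear map $f\colon\overline C\to\overline D$ with $(f\otimes f)\circ\overline\Delta=\overline\Delta\circ f$ and a map of sets $i\colon G\to S$ such that $f({}^g\overline C{}^h)\subseteq{}^{i(g)}\overline D{}^{i(h)}$ for all $g,h\in G$. Then the category of pointed coalgebras with a splitting over $k$ has all small limits and all small colimits. The category of reduced colored coalgebras over $k$ is equivalent to it, and therefore also has all small limits and all small colimits. -/

import Mathlib

open CategoryTheory CategoryTheory.Limits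
open scoped TensorProduct

universe u

/-! ### Subcoalgebras, the coradical and pointed coalgebras over a field -/

section Coradical

variable (k : Type u) [Field k] {C : Type u} [AddCommGroup C] [Module k C] [Coalgebra k C]

/-- A subspace `D` of a coalgebra is a subcoalgebra if `Δ(D) ⊆ D ⊗ D`
(where `D ⊗ D` is identified with its image in `C ⊗ C`). -/
def IsSubcoalgebra (D : Submodule k C) : Prop :=
  ∀ x ∈ D, Coalgebra.comul (R := k) x ∈ LinearMap.range (TensorProduct.mapIncl D D)

/-- A cosimple subcoalgebra: nonzero, with no subcoalgebras other than zero and itself. -/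
structure IsCosimpleSubcoalgebra (D : Submodule k C) : Prop where
  isSubcoalgebra : IsSubcoalgebra k D
  ne_bot : D ≠ ⊥
  eq_bot_or_eq : ∀ E : Submodule k C, IsSubcoalgebra k E → E ≤ D → E = ⊥ ∨ E = D

variable (C)

/-- The coradical: the sum of all cosimple subcoalgebras. -/
def coradical : Submodule k C :=
  sSup {D : Submodule k C | IsCosimpleSubcoalgebra k D}

/-- A coalgebra is pointed if every cosimple subcoalgebra is one-dimensional. -/
def IsPointedCoalgebra : Prop :=
  ∀ D : Submodule k C, IsCosimpleSubcoalgebra k D → Module.finrank k D = 1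

end Coradical

/-! ### The category of pointed coalgebras with a splitting -/

/-- A pointed coalgebra `C` with a splitting `δ : C → C₀` of its coradical `C₀`.
The coalgebra homomorphism `δ` is recorded as a coalgebra endomorphism of `C` whose image is `C₀`;
that it splits the inclusion means that it is the identity on `C₀`, so that `C = C₀ ⊕ ker δ`. -/
structure PointedSplitCoalg (k : Type u) [Field k] where
  carrier : Type u
  [addCommGroup : AddCommGroup carrier]
  [module : Module k carrier]
  [coalgebra : Coalgebra k carrier]
  pointed : IsPointedCoalgebra k carrier
  split : carrier →ₗc[k] carrier
  range_split : LinearMap.range split.toLinearMap = coradical k carrier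
  split_apply : ∀ x ∈ coradical k carrier, split x = x

namespace PointedSplitCoalg

attribute [instance] addCommGroup module coalgebra

variable {k : Type u} [Field k]

/-- A morphism is a coalgebra homomorphism that commutes with the splittings. -/
@[ext]
structure Hom (X Y : PointedSplitCoalg k) where
  toCoalgHom : X.carrier →ₗc[k] Y.carrier
  map_split : ∀ x, toCoalgHom (X.split x) = Y.split (toCoalgHom x)

instance : Category (PointedSplitCoalg k) where
  Hom X Y := Hom X Y
  id X := ⟨CoalgHom.id k X.carrier, fun _ => rfl⟩
  comp f g := ⟨g.toCoalgHom.comp f.toCoalgHom, fun x => by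
    simp [f.map_split, g.map_split]⟩

end PointedSplitCoalg

/-! ### The category of reduced colored coalgebras -/

section IteratedComul

variable (k : Type u) [Field k] {C : Type u} [AddCommGroup C] [Module k C]

variable (C) in
/-- The right-nested tensor power `C ⊗ (C ⊗ (⋯ ⊗ C))` with `n + 1` factors. -/
def nestedTensorPower : ℕ → ModuleCat.{u} k
  | 0 => ModuleCat.of k C
  | n + 1 => ModuleCat.of k (C ⊗[k] nestedTensorPower n)

/-- The iterated comultiplication `Δⁿ : C → C ⊗ (C ⊗ (⋯ ⊗ C))` (with `n + 1` factors):
`Δ⁰ = id` and `Δⁿ⁺¹ = (id ⊗ Δⁿ) ∘ Δ`. -/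
noncomputable def iteratedComul (Δ : C →ₗ[k] C ⊗[k] C) :
    (n : ℕ) → C →ₗ[k] nestedTensorPower k C n
  | 0 => LinearMap.id
  | n + 1 => (iteratedComul Δ n).lTensor C ∘ₗ Δ

end IteratedComul

/-- A reduced colored coalgebra `(C, G)`: a coassociative, conilpotent coalgebra `C`, not assumed
to have a counit, with a `G`-bigrading `C = ⨁ ᵍCʰ` such that `Δ(ᵍCʰ) ⊆ ∑ₛ ᵍCˢ ⊗ ˢCʰ`. -/
structure ReducedColoredCoalg (k : Type u) [Field k] where
  carrier : Type u
  [addCommGroup : AddCommGroup carrier]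
  [module : Module k carrier]
  /-- the set `G` of colors -/
  colors : Type u
  /-- the homogeneous component `ᵍCʰ` -/
  component : colors → colors → Submodule k carrier
  iSupIndep_component : iSupIndep fun p : colors × colors => component p.1 p.2
  iSup_component : ⨆ p : colors × colors, component p.1 p.2 = ⊤
  /-- the comultiplication -/
  comul : carrier →ₗ[k] carrier ⊗[k] carrier
  coassoc : TensorProduct.assoc k carrier carrier carrier ∘ₗ comul.rTensor carrier ∘ₗ comul =
    comul.lTensor carrier ∘ₗ comul
  comul_mem : ∀ (g h : colors), ∀ x ∈ component g h,
    comul x ∈ ⨆ s : colors,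
      LinearMap.range (TensorProduct.mapIncl (component g s) (component s h))
  conilpotent : ∀ x : carrier, ∃ n : ℕ, iteratedComul k comul n x = 0

namespace ReducedColoredCoalg

attribute [instance] addCommGroup module

variable {k : Type u} [Field k]

/-- A morphism `(f, i) : (C, G) → (D, S)` is a linear map `f` preserving the comultiplication
together with a map of sets `i : G → S` such that `f(ᵍCʰ) ⊆ ⁱ⁽ᵍ⁾Dⁱ⁽ʰ⁾`. -/
@[ext]
structure Hom (X Y : ReducedColoredCoalg k) where
  toLinearMap : X.carrier →ₗ[k] Y.carrier
  onColors : X.colors → Y.colors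
  map_mem : ∀ (g h : X.colors), ∀ x ∈ X.component g h,
    toLinearMap x ∈ Y.component (onColors g) (onColors h)
  map_comul : TensorProduct.map toLinearMap toLinearMap ∘ₗ X.comul = Y.comul ∘ₗ toLinearMap

instance : Category (ReducedColoredCoalg k) where
  Hom X Y := Hom X Y
  id X := ⟨LinearMap.id, id, fun _ _ _ hx => hx, by simp⟩
  comp f g := ⟨g.toLinearMap ∘ₗ f.toLinearMap, g.onColors ∘ f.onColors,
    fun _ _ _ hx => g.map_mem _ _ _ (f.map_mem _ _ _ hx), by
      rw [TensorProduct.map_comp, LinearMap.comp_assoc, f.map_comul, ← LinearMap.comp_assoc,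
        g.map_comul, LinearMap.comp_assoc]⟩

end ReducedColoredCoalg

/-!
The two categories are equivalent, so it is enough to construct limits and colimits of reduced
colored coalgebras.

*The equivalence.* A reduced colored coalgebra `(C, G)` gives the vector space `kG ⊕ C`, with
group-like colors and `Δ x = g ⊗ x + x ⊗ h + Δ̄ x` for `x ∈ ᵍCʰ`. Conilpotency of `C` implies that
every nonzero subcoalgebra of `kG ⊕ C` contains a color (`ReducedColoredCoalg.exists_pt_mem`), so
that `kG ⊕ C` is pointed with coradical `kG`, and the projection onto `kG` is a splitting.
Conversely, the kernel of a splitting `δ : C → C₀` inherits a coassociative comultiplication, since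
`ker δ` is the quotient of `C` by `C₀`, and it is graded by pairs of group-like elements through the
coactions of `C₀ = kG(C)` on both sides (`PointedSplitCoalg.reduced`). Its conilpotency is the
exhaustiveness of the coradical filtration (`IsPointedCoalgebra.exists_mem_hitFiltration`). The
latter is proved by letting the dual space act on `C` by `a ⇀ x = a(x₁) x₂` and `x ↼ b = b(x₂) x₁`:
in a pointed coalgebra a minimal stable subspace is spanned by a group-like element
(`IsPointedCoalgebra.exists_eq_span_isGroupLikeElem`), and every minimal extension `W ⋖ W'` of
stable subspaces has its quotient embedded in `C` by one of the actions, so that a functional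
vanishing on the coradical maps `W'` into `W`. The functor `(C, G) ↦ kG ⊕ C`
(`ReducedColoredCoalg.totalFunctor`) is fully faithful and essentially surjective.

*Colimits* of reduced colored coalgebras are computed in vector spaces and sets. The only point that
is not formal is the independence of the components of the colimit, which holds because the
homogeneous projections of the terms of the diagram, followed by the coprojections, are compatible.

*Limits* exist because the category is a reflective subcategory of a category of presheaves. Each
finite subset of a reduced colored coalgebra lies in a finite-dimensional subobject with finitely
many colors (`ReducedColoredCoalg.exists_finiteModel`), and the finite-dimensional objects with
finitely many colors are, up to isomorphism, the finite models `FiniteModel`, which form a small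
category. Hence the finite models are dense: the functor `modelPoints` to presheaves on them is
fully faithful. It has a left adjoint because the category has colimits.
-/

/-! ### Slices of tensors -/

section Slices

variable {k : Type*} [Field k] {M N P Q : Type*} [AddCommGroup M] [Module k M]
  [AddCommGroup N] [Module k N] [AddCommGroup P] [Module k P] [AddCommGroup Q] [Module k Q]

/-- Contraction of the left leg of a tensor with a functional: `m ⊗ n ↦ a(m) n`. -/
noncomputable def evalLeft (a : Module.Dual k M) : M ⊗[k] N →ₗ[k] N :=
  TensorProduct.lid k N ∘ₗ a.rTensor N

/-- Contraction of the right leg of a tensor with a functional: `m ⊗ n ↦ b(n) m`. -/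
noncomputable def evalRight (b : Module.Dual k N) : M ⊗[k] N →ₗ[k] M :=
  TensorProduct.rid k M ∘ₗ b.lTensor M

@[simp] lemma evalLeft_tmul (a : Module.Dual k M) (m : M) (n : N) :
    evalLeft a (m ⊗ₜ[k] n) = a m • n := by simp [evalLeft]

@[simp] lemma evalRight_tmul (b : Module.Dual k N) (m : M) (n : N) :
    evalRight b (m ⊗ₜ[k] n) = b n • m := by simp [evalRight]

lemma evalLeft_map (a : Module.Dual k P) (f : M →ₗ[k] P) (g : N →ₗ[k] Q) (t : M ⊗[k] N) :
    evalLeft a (TensorProduct.map f g t) = g (evalLeft (a ∘ₗ f) t) := by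
  induction t <;> simp_all

lemma evalRight_map (b : Module.Dual k Q) (f : M →ₗ[k] P) (g : N →ₗ[k] Q) (t : M ⊗[k] N) :
    evalRight b (TensorProduct.map f g t) = f (evalRight (b ∘ₗ g) t) := by
  induction t <;> simp_all

lemma evalLeft_lTensor (a : Module.Dual k M) (g : N →ₗ[k] Q) (t : M ⊗[k] N) :
    evalLeft a (g.lTensor M t) = g (evalLeft a t) := evalLeft_map a LinearMap.id g t

lemma evalLeft_rTensor (a : Module.Dual k P) (f : M →ₗ[k] P) (t : M ⊗[k] N) :
    evalLeft a (f.rTensor N t) = evalLeft (a ∘ₗ f) t := evalLeft_map a f LinearMap.id t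

lemma evalRight_rTensor (b : Module.Dual k N) (f : M →ₗ[k] P) (t : M ⊗[k] N) :
    evalRight b (f.rTensor N t) = f (evalRight b t) := evalRight_map b f LinearMap.id t

lemma evalRight_lTensor (b : Module.Dual k Q) (g : N →ₗ[k] Q) (t : M ⊗[k] N) :
    evalRight b (g.lTensor M t) = evalRight (b ∘ₗ g) t := evalRight_map b LinearMap.id g t

lemma evalLeft_assoc_rTensor (a : Module.Dual k M) (f : P →ₗ[k] M ⊗[k] N) (t : P ⊗[k] Q) :
    evalLeft a (TensorProduct.assoc k M N Q (f.rTensor Q t)) = (evalLeft a ∘ₗ f).rTensor Q t := by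
  induction t with
  | zero => simp
  | add => simp_all
  | tmul x y =>
    simp only [LinearMap.rTensor_tmul, LinearMap.comp_apply]
    generalize f x = s
    induction s with
    | zero => simp
    | add => simp_all [TensorProduct.add_tmul]
    | tmul => simp [TensorProduct.smul_tmul']

lemma lTensor_evalRight_assoc (b : Module.Dual k Q) (t : (M ⊗[k] N) ⊗[k] Q) :
    (evalRight b).lTensor M (TensorProduct.assoc k M N Q t) = evalRight b t := by
  induction t with
  | zero => simp
  | add => simp_all
  | tmul x y =>
    induction x with
    | zero => simp
    | add => simp_all [TensorProduct.add_tmul]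
    | tmul => simp

lemma lTensor_evalLeft_assoc (a : Module.Dual k N) (t : (M ⊗[k] N) ⊗[k] Q) :
    (evalLeft a).lTensor M (TensorProduct.assoc k M N Q t) = (evalRight a).rTensor Q t := by
  induction t with
  | zero => simp
  | add => simp_all
  | tmul x y =>
    induction x with
    | zero => simp
    | add => simp_all [TensorProduct.add_tmul]
    | tmul => simp [TensorProduct.smul_tmul]

/-- Over a field, tensors are separated by their slices. -/
lemma eq_of_evalLeft_eq {t s : M ⊗[k] N} (h : ∀ a : Module.Dual k M, evalLeft a t = evalLeft a s) :
    t = s := by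
  classical
  let b := Module.Basis.ofVectorSpace k M
  apply (TensorProduct.equivFinsuppOfBasisLeft (N := N) b).injective
  ext i
  have key : ∀ t : M ⊗[k] N,
      TensorProduct.equivFinsuppOfBasisLeft b t i = evalLeft (b.coord i) t := by
    intro t
    induction t with
    | zero => simp
    | add => simp_all
    | tmul => simp
  rw [key, key, h]

lemma eq_of_evalRight_eq {t s : M ⊗[k] N}
    (h : ∀ b : Module.Dual k N, evalRight b t = evalRight b s) : t = s := by
  apply (TensorProduct.comm k M N).injective
  have key : ∀ (b : Module.Dual k N) (t : M ⊗[k] N),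
      evalLeft b (TensorProduct.comm k M N t) = evalRight b t := by
    intro b t
    induction t <;> simp_all
  exact eq_of_evalLeft_eq fun b => by rw [key, key, h]

/-- Over a field, every subspace admits a linear retraction. -/
lemma Submodule.exists_projection (D : Submodule k M) :
    ∃ π : M →ₗ[k] D, ∀ x (hx : x ∈ D), π x = ⟨x, hx⟩ := by
  obtain ⟨π, hπ⟩ := D.subtype.exists_leftInverse_of_injective D.ker_subtype
  exact ⟨π, fun x hx => LinearMap.congr_fun hπ ⟨x, hx⟩⟩

/-- Over a field, a tensor whose slices lie in `D` and `E` lies in `D ⊗ E`. -/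
lemma mem_range_mapIncl {D : Submodule k M} {E : Submodule k N} {t : M ⊗[k] N}
    (hE : ∀ a : Module.Dual k M, evalLeft a t ∈ E) (hD : ∀ b : Module.Dual k N, evalRight b t ∈ D) :
    t ∈ LinearMap.range (TensorProduct.mapIncl D E) := by
  obtain ⟨π, hπ⟩ := D.exists_projection
  obtain ⟨ρ, hρ⟩ := E.exists_projection
  refine ⟨TensorProduct.map π ρ t, ?_⟩
  have h1 : (E.subtype ∘ₗ ρ).lTensor M t = t := eq_of_evalLeft_eq fun a => by
    rw [evalLeft_lTensor]; simp [hρ _ (hE a)]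
  have h2 : (D.subtype ∘ₗ π).rTensor N t = t := eq_of_evalRight_eq fun a => by
    rw [evalRight_rTensor]; simp [hπ _ (hD a)]
  calc _ = (D.subtype ∘ₗ π).rTensor N ((E.subtype ∘ₗ ρ).lTensor M t) := by
        rw [TensorProduct.mapIncl, ← LinearMap.comp_apply, ← TensorProduct.map_comp,
          ← LinearMap.comp_apply, LinearMap.rTensor_comp_lTensor]
    _ = t := by rw [h1, h2]

lemma evalLeft_mem_of_mem_range {D : Submodule k M} {E : Submodule k N} {t : M ⊗[k] N}
    (h : t ∈ LinearMap.range (TensorProduct.mapIncl D E)) (a : Module.Dual k M) :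
    evalLeft a t ∈ E := by
  obtain ⟨s, rfl⟩ := h
  rw [TensorProduct.mapIncl, evalLeft_map]
  exact Subtype.property _

lemma evalRight_mem_of_mem_range {D : Submodule k M} {E : Submodule k N} {t : M ⊗[k] N}
    (h : t ∈ LinearMap.range (TensorProduct.mapIncl D E)) (b : Module.Dual k N) :
    evalRight b t ∈ D := by
  obtain ⟨s, rfl⟩ := h
  rw [TensorProduct.mapIncl, evalRight_map]
  exact Subtype.property _

/-- The slices of a tensor all lie in one finite-dimensional subspace. -/
lemma exists_finiteDimensional_evalLeft (t : M ⊗[k] N) :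
    ∃ E : Submodule k N, FiniteDimensional k E ∧ ∀ a : Module.Dual k M, evalLeft a t ∈ E := by
  induction t with
  | zero => exact ⟨⊥, inferInstance, by simp⟩
  | tmul x y =>
    exact ⟨k ∙ y, inferInstance, fun a => by
      simpa using Submodule.smul_mem _ _ (Submodule.mem_span_singleton_self y)⟩
  | add s t hs ht =>
    obtain ⟨E, _, hE⟩ := hs
    obtain ⟨F, _, hF⟩ := ht
    exact ⟨E ⊔ F, inferInstance, fun a => by
      rw [map_add]; exact Submodule.add_mem_sup (hE a) (hF a)⟩

lemma exists_finiteDimensional_evalRight (t : M ⊗[k] N) :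
    ∃ E : Submodule k M, FiniteDimensional k E ∧ ∀ b : Module.Dual k N, evalRight b t ∈ E := by
  induction t with
  | zero => exact ⟨⊥, inferInstance, by simp⟩
  | tmul x y =>
    exact ⟨k ∙ x, inferInstance, fun a => by
      simpa using Submodule.smul_mem _ _ (Submodule.mem_span_singleton_self x)⟩
  | add s t hs ht =>
    obtain ⟨E, _, hE⟩ := hs
    obtain ⟨F, _, hF⟩ := ht
    exact ⟨E ⊔ F, inferInstance, fun a => by
      rw [map_add]; exact Submodule.add_mem_sup (hE a) (hF a)⟩

end Slices

/-! ### The actions of the dual space on a coalgebra -/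

section Hit

variable {k : Type*} [Field k] {C : Type*} [AddCommGroup C] [Module k C]
  {D : Type*} [AddCommGroup D] [Module k D]
  (Δ : C →ₗ[k] C ⊗[k] C)

/-- The action `x ↦ a(x₁) x₂` of a functional `a` on a (not necessarily counital) coalgebra. -/
noncomputable def hitLeft (a : Module.Dual k C) : C →ₗ[k] C := evalLeft a ∘ₗ Δ

/-- The action `x ↦ b(x₂) x₁` of a functional `b` on a (not necessarily counital) coalgebra. -/
noncomputable def hitRight (b : Module.Dual k C) : C →ₗ[k] C := evalRight b ∘ₗ Δ

lemma hitLeft_apply (a : Module.Dual k C) (x : C) : hitLeft Δ a x = evalLeft a (Δ x) := rfl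

lemma hitRight_apply (b : Module.Dual k C) (x : C) : hitRight Δ b x = evalRight b (Δ x) := rfl

variable {Δ}

section Coassoc

variable (h : TensorProduct.assoc k C C C ∘ₗ Δ.rTensor C ∘ₗ Δ = Δ.lTensor C ∘ₗ Δ)
include h

lemma comul_hitLeft (a : Module.Dual k C) (x : C) :
    Δ (hitLeft Δ a x) = (hitLeft Δ a).rTensor C (Δ x) := by
  have := congrArg (evalLeft a) (LinearMap.congr_fun h x)
  simp only [LinearMap.comp_apply, LinearEquiv.coe_coe, evalLeft_assoc_rTensor,
    evalLeft_lTensor] at this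
  exact this.symm

lemma comul_hitRight (b : Module.Dual k C) (x : C) :
    Δ (hitRight Δ b x) = (hitRight Δ b).lTensor C (Δ x) := by
  have := congrArg ((evalRight b).lTensor C) (LinearMap.congr_fun h x)
  simp only [LinearMap.comp_apply, LinearEquiv.coe_coe, lTensor_evalRight_assoc,
    evalRight_rTensor] at this
  rw [hitRight_apply, this, ← LinearMap.comp_apply (LinearMap.lTensor C _),
    ← LinearMap.lTensor_comp]
  rfl

lemma rTensor_hitRight_comul (a : Module.Dual k C) (x : C) :
    (hitRight Δ a).rTensor C (Δ x) = (hitLeft Δ a).lTensor C (Δ x) := by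
  have := congrArg ((evalLeft a).lTensor C) (LinearMap.congr_fun h x)
  simp only [LinearMap.comp_apply, LinearEquiv.coe_coe, lTensor_evalLeft_assoc] at this
  rw [← LinearMap.comp_apply, ← LinearMap.comp_apply (LinearMap.lTensor C _),
    ← LinearMap.lTensor_comp, ← LinearMap.rTensor_comp] at this
  exact this

lemma hitLeft_hitRight (a b : Module.Dual k C) (x : C) :
    hitLeft Δ a (hitRight Δ b x) = hitRight Δ b (hitLeft Δ a x) := by
  rw [hitLeft_apply, comul_hitRight h, evalLeft_lTensor, ← hitLeft_apply]

lemma hitLeft_hitLeft (a b : Module.Dual k C) (x : C) :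
    hitLeft Δ a (hitLeft Δ b x) = hitLeft Δ (a ∘ₗ hitLeft Δ b) x := by
  rw [hitLeft_apply, comul_hitLeft h, evalLeft_rTensor, ← hitLeft_apply]

lemma hitRight_hitRight (a b : Module.Dual k C) (x : C) :
    hitRight Δ a (hitRight Δ b x) = hitRight Δ (a ∘ₗ hitRight Δ b) x := by
  rw [hitRight_apply, comul_hitRight h, evalRight_lTensor, ← hitRight_apply]

/-- A finite-dimensional subspace is contained in a finite-dimensional subspace that contains
all its translates under the two dual actions and is stable under them. -/
lemma exists_finiteDimensional_stable (W : Submodule k C) [FiniteDimensional k W] :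
    ∃ E : Submodule k C, FiniteDimensional k E ∧
      (∀ x ∈ W, ∀ a b, hitRight Δ b (hitLeft Δ a x) ∈ E) ∧
      (∀ x ∈ E, ∀ a, hitLeft Δ a x ∈ E) ∧ (∀ x ∈ E, ∀ b, hitRight Δ b x ∈ E) := by
  have hL : ∀ W : Submodule k C, FiniteDimensional k W →
      FiniteDimensional k (⨆ a, W.map (hitLeft Δ a) : Submodule k C) := by
    intro W hW
    obtain ⟨S, rfl⟩ := (Module.Finite.iff_fg.mp hW)
    choose E hE hE' using fun x : C => exists_finiteDimensional_evalLeft (Δ x)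
    refine Submodule.finiteDimensional_of_le (S₂ := S.sup E) ?_
    refine iSup_le fun a => ?_
    rw [Submodule.map_span, Submodule.span_le]
    rintro _ ⟨x, hx, rfl⟩
    exact (Finset.le_sup (f := E) hx) (hE' x a)
  have hR : ∀ W : Submodule k C, FiniteDimensional k W →
      FiniteDimensional k (⨆ a, W.map (hitRight Δ a) : Submodule k C) := by
    intro W hW
    obtain ⟨S, rfl⟩ := (Module.Finite.iff_fg.mp hW)
    choose E hE hE' using fun x : C => exists_finiteDimensional_evalRight (Δ x)
    refine Submodule.finiteDimensional_of_le (S₂ := S.sup E) ?_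
    refine iSup_le fun a => ?_
    rw [Submodule.map_span, Submodule.span_le]
    rintro _ ⟨x, hx, rfl⟩
    exact (Finset.le_sup (f := E) hx) (hE' x a)
  refine ⟨⨆ b, (⨆ a, W.map (hitLeft Δ a)).map (hitRight Δ b), hR _ (hL _ ‹_›), ?_, ?_, ?_⟩
  · intro x hx a b
    exact Submodule.mem_iSup_of_mem b (Submodule.mem_map_of_mem
      (Submodule.mem_iSup_of_mem a (Submodule.mem_map_of_mem hx)))
  · intro x hx c
    have : (⨆ b, (⨆ a, W.map (hitLeft Δ a)).map (hitRight Δ b)) ≤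
        (⨆ b, (⨆ a, W.map (hitLeft Δ a)).map (hitRight Δ b)).comap (hitLeft Δ c) := by
      simp only [Submodule.map_iSup]
      refine iSup_le fun b => iSup_le fun a => ?_
      rintro _ ⟨_, ⟨x, hx, rfl⟩, rfl⟩
      rw [Submodule.mem_comap, hitLeft_hitRight h, hitLeft_hitLeft h]
      exact Submodule.mem_iSup_of_mem b (Submodule.mem_iSup_of_mem _
        (Submodule.mem_map_of_mem (Submodule.mem_map_of_mem hx)))
    exact this hx
  · intro x hx c
    have : (⨆ b, (⨆ a, W.map (hitLeft Δ a)).map (hitRight Δ b)) ≤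
        (⨆ b, (⨆ a, W.map (hitLeft Δ a)).map (hitRight Δ b)).comap (hitRight Δ c) := by
      refine iSup_le fun b => ?_
      rintro _ ⟨x, hx, rfl⟩
      rw [Submodule.mem_comap, hitRight_hitRight h]
      exact Submodule.mem_iSup_of_mem _ (Submodule.mem_map_of_mem hx)
    exact this hx

end Coassoc

lemma hitLeft_map {Δ' : D →ₗ[k] D ⊗[k] D} {f : C →ₗ[k] D} {x : C}
    (hf : Δ' (f x) = TensorProduct.map f f (Δ x)) (a : Module.Dual k D) :
    hitLeft Δ' a (f x) = f (hitLeft Δ (a ∘ₗ f) x) := by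
  rw [hitLeft_apply, hf, evalLeft_map, ← hitLeft_apply]

lemma hitRight_map {Δ' : D →ₗ[k] D ⊗[k] D} {f : C →ₗ[k] D} {x : C}
    (hf : Δ' (f x) = TensorProduct.map f f (Δ x)) (a : Module.Dual k D) :
    hitRight Δ' a (f x) = f (hitRight Δ (a ∘ₗ f) x) := by
  rw [hitRight_apply, hf, evalRight_map, ← hitRight_apply]

variable (Δ)

/-- The filtration of a coalgebra by the elements that are killed by any `n` successive actions of
functionals from `I`. If `I` consists of all functionals, its `n`-th term is the kernel of the
`n`-fold iterated comultiplication. -/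
noncomputable def hitFiltration (I : Set (Module.Dual k C)) : ℕ → Submodule k C
  | 0 => ⊥
  | n + 1 => ⨅ a ∈ I, (hitFiltration I n).comap (hitLeft Δ a)

variable {Δ}

lemma mem_hitFiltration_succ {I : Set (Module.Dual k C)} {n : ℕ} {x : C} :
    x ∈ hitFiltration Δ I (n + 1) ↔ ∀ a ∈ I, hitLeft Δ a x ∈ hitFiltration Δ I n := by
  simp [hitFiltration]

lemma hitFiltration_mono (I : Set (Module.Dual k C)) : Monotone (hitFiltration Δ I) := by
  refine monotone_nat_of_le_succ fun n => ?_
  induction n with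
  | zero => exact bot_le
  | succ n ih =>
    intro x hx
    refine mem_hitFiltration_succ.2 fun a ha => ?_
    exact ih (mem_hitFiltration_succ.1 hx a ha)

lemma map_mem_hitFiltration {Δ' : D →ₗ[k] D ⊗[k] D} {f : C →ₗ[k] D}
    (hf : ∀ x, Δ' (f x) = TensorProduct.map f f (Δ x)) {I : Set (Module.Dual k C)}
    {I' : Set (Module.Dual k D)} (hI : ∀ a ∈ I', a ∘ₗ f ∈ I) {n : ℕ} {x : C}
    (hx : x ∈ hitFiltration Δ I n) : f x ∈ hitFiltration Δ' I' n := by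
  induction n generalizing x with
  | zero =>
    obtain rfl : x = 0 := hx
    simp
  | succ n ih =>
    refine mem_hitFiltration_succ.2 fun a ha => ?_
    rw [hitLeft_map (hf x)]
    exact ih (mem_hitFiltration_succ.1 hx _ (hI a ha))

end Hit

lemma ker_iteratedComul {k : Type u} [Field k] {C : Type u} [AddCommGroup C] [Module k C]
    (Δ : C →ₗ[k] C ⊗[k] C) (n : ℕ) (x : C) :
    iteratedComul k Δ n x = 0 ↔ x ∈ hitFiltration Δ Set.univ n := by
  induction n generalizing x with
  | zero => exact Iff.rfl
  | succ n ih =>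
    have h0 : iteratedComul k Δ (n + 1) x = (iteratedComul k Δ n).lTensor C (Δ x) := rfl
    rw [mem_hitFiltration_succ, h0]
    simp only [Set.mem_univ, forall_const, ← ih, hitLeft_apply, ← evalLeft_lTensor]
    refine ⟨fun h a => ?_, fun h => eq_of_evalLeft_eq fun a => ?_⟩
    · exact (congrArg (evalLeft a) h).trans (map_zero _)
    · exact (h a).trans (map_zero _).symm

/-! ### Subcoalgebras of a counital coalgebra -/

lemma Submodule.exists_minimal_of_finiteDimensional {k V : Type*} [Field k] [AddCommGroup V]
    [Module k V] (p : Submodule k V → Prop) (E : Submodule k V) [FiniteDimensional k E] (hE : p E) :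
    ∃ M ≤ E, p M ∧ ∀ N ≤ M, p N → N = M := by
  classical
  have hex : ∃ n, ∃ M ≤ E, p M ∧ Module.finrank k M = n := ⟨_, E, le_rfl, hE, rfl⟩
  obtain ⟨M, hME, hM, hn⟩ := Nat.find_spec hex
  have : FiniteDimensional k M := Submodule.finiteDimensional_of_le hME
  refine ⟨M, hME, hM, fun N hN hpN => Submodule.eq_of_le_of_finrank_le hN ?_⟩
  rw [hn]
  exact Nat.find_min' hex ⟨N, hN.trans hME, hpN, rfl⟩

section Counital

variable {k : Type u} [Field k] {C : Type u} [AddCommGroup C] [Module k C] [Coalgebra k C]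

local notation "Δ" => (Coalgebra.comul (R := k) (A := C))

@[simp] lemma hitLeft_counit (x : C) : hitLeft Δ (Coalgebra.counit (R := k)) x = x := by
  simp [hitLeft, evalLeft]

@[simp] lemma hitRight_counit (x : C) : hitRight Δ (Coalgebra.counit (R := k)) x = x := by
  simp [hitRight, evalRight]

lemma apply_hitRight (a b : Module.Dual k C) (x : C) :
    a (hitRight Δ b x) = b (hitLeft Δ a x) := by
  rw [hitRight_apply, hitLeft_apply]
  generalize Δ x = t
  induction t with
  | zero => simp
  | add => simp_all
  | tmul => simp [mul_comm]

lemma counit_hitRight (b : Module.Dual k C) (x : C) :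
    Coalgebra.counit (R := k) (hitRight Δ b x) = b x := by
  rw [apply_hitRight, hitLeft_counit]

lemma IsGroupLikeElem.hitLeft {g : C} (hg : IsGroupLikeElem k g) (a : Module.Dual k C) :
    hitLeft Δ a g = a g • g := by
  simp [hitLeft_apply, hg.comul_eq_tmul_self]

lemma IsGroupLikeElem.hitRight {g : C} (hg : IsGroupLikeElem k g) (a : Module.Dual k C) :
    hitRight Δ a g = a g • g := by
  simp [hitRight_apply, hg.comul_eq_tmul_self]

lemma isSubcoalgebra_iff {D : Submodule k C} : IsSubcoalgebra k D ↔
    (∀ x ∈ D, ∀ a, hitLeft Δ a x ∈ D) ∧ (∀ x ∈ D, ∀ b, hitRight Δ b x ∈ D) :=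
  ⟨fun h => ⟨fun x hx a => evalLeft_mem_of_mem_range (h x hx) a,
    fun x hx b => evalRight_mem_of_mem_range (h x hx) b⟩,
    fun h x hx => mem_range_mapIncl (h.1 x hx) (h.2 x hx)⟩

lemma IsGroupLikeElem.isSubcoalgebra_span {g : C} (hg : IsGroupLikeElem k g) :
    IsSubcoalgebra k (k ∙ g) := by
  refine isSubcoalgebra_iff.2 ⟨?_, ?_⟩ <;> intro x hx a <;>
    obtain ⟨c, rfl⟩ := Submodule.mem_span_singleton.1 hx
  · rw [map_smul, hg.hitLeft]
    exact Submodule.smul_mem _ _ (Submodule.smul_mem _ _ (Submodule.mem_span_singleton_self g))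
  · rw [map_smul, hg.hitRight]
    exact Submodule.smul_mem _ _ (Submodule.smul_mem _ _ (Submodule.mem_span_singleton_self g))

lemma IsGroupLikeElem.isCosimpleSubcoalgebra_span {g : C} (hg : IsGroupLikeElem k g) :
    IsCosimpleSubcoalgebra k (k ∙ g) where
  isSubcoalgebra := hg.isSubcoalgebra_span
  ne_bot := by simpa using hg.ne_zero
  eq_bot_or_eq E _ hE := (nonzero_span_atom g hg.ne_zero).le_iff.1 hE

lemma IsGroupLikeElem.mem_coradical {g : C} (hg : IsGroupLikeElem k g) : g ∈ coradical k C :=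
  Submodule.mem_sSup_of_mem hg.isCosimpleSubcoalgebra_span (Submodule.mem_span_singleton_self g)

/-- A one-dimensional subcoalgebra is spanned by a group-like element. -/
lemma exists_isGroupLikeElem_of_finrank_eq_one {D : Submodule k C} (hD : IsSubcoalgebra k D)
    (h1 : Module.finrank k D = 1) : ∃ g, IsGroupLikeElem k g ∧ D = k ∙ g := by
  obtain ⟨⟨v, hv⟩, hv0, hvD⟩ := finrank_eq_one_iff'.1 h1
  have hv0' : v ≠ 0 := fun h => hv0 (Subtype.ext h)
  replace hvD : ∀ w ∈ D, ∃ c : k, c • v = w := fun w hw => by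
    obtain ⟨c, hc⟩ := hvD ⟨w, hw⟩
    exact ⟨c, congrArg Subtype.val hc⟩
  obtain ⟨c, hc⟩ : ∃ c : k, Δ v = c • v ⊗ₜ[k] v := by
    obtain ⟨s, hs⟩ := hD v hv
    rw [← hs]
    clear hs
    induction s with
    | zero => exact ⟨0, by simp⟩
    | add s t hs ht =>
      obtain ⟨c, hc⟩ := hs
      obtain ⟨d, hd⟩ := ht
      exact ⟨c + d, by rw [map_add, hc, hd, add_smul]⟩
    | tmul x y =>
      obtain ⟨c, hc⟩ := hvD x x.2
      obtain ⟨d, hd⟩ := hvD y y.2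
      exact ⟨c * d, by
        simp only [TensorProduct.mapIncl, TensorProduct.map_tmul, Submodule.subtype_apply]
        rw [← hc, ← hd, TensorProduct.smul_tmul_smul]⟩
  have hcv : c * Coalgebra.counit (R := k) v = 1 := by
    have := hitLeft_counit (k := k) v
    rw [hitLeft_apply, hc, map_smul, evalLeft_tmul, smul_smul] at this
    exact smul_left_injective k hv0' (by simpa using this)
  have hc0 : c ≠ 0 := by rintro rfl; simp at hcv
  refine ⟨c • v, ⟨by simpa using hcv, by
    rw [map_smul, hc, TensorProduct.smul_tmul_smul, smul_smul]⟩, le_antisymm ?_ ?_⟩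
  · intro w hw
    obtain ⟨d, rfl⟩ := hvD w hw
    exact Submodule.mem_span_singleton.2 ⟨d * c⁻¹, by rw [smul_smul, mul_assoc,
      inv_mul_cancel₀ hc0, mul_one]⟩
  · simpa using D.smul_mem c hv

lemma coradical_eq_span (hC : IsPointedCoalgebra k C) :
    coradical k C = Submodule.span k {g : C | IsGroupLikeElem k g} := by
  refine le_antisymm (sSup_le fun D hD => ?_) (Submodule.span_le.2 fun g hg => hg.mem_coradical)
  obtain ⟨g, hg, rfl⟩ := exists_isGroupLikeElem_of_finrank_eq_one hD.isSubcoalgebra (hC D hD)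
  exact Submodule.span_mono (by simpa using hg)

/-- In a pointed coalgebra, every nonzero finite-dimensional subcoalgebra contains a group-like
element. -/
lemma IsPointedCoalgebra.exists_isGroupLikeElem_mem (hC : IsPointedCoalgebra k C)
    {D : Submodule k C} [FiniteDimensional k D] (hD : IsSubcoalgebra k D) (h0 : D ≠ ⊥) :
    ∃ g ∈ D, IsGroupLikeElem k g := by
  obtain ⟨M, hMD, ⟨hM, hM0⟩, hmin⟩ := Submodule.exists_minimal_of_finiteDimensional
    (fun E => IsSubcoalgebra k E ∧ E ≠ ⊥) D ⟨hD, h0⟩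
  have hcos : IsCosimpleSubcoalgebra k M :=
    ⟨hM, hM0, fun E hE hEM => or_iff_not_imp_left.2 fun hE0 => hmin E hEM ⟨hE, hE0⟩⟩
  obtain ⟨g, hg, rfl⟩ := exists_isGroupLikeElem_of_finrank_eq_one hM (hC M hcos)
  exact ⟨g, hMD (Submodule.mem_span_singleton_self g), hg⟩

/-! ### Conilpotency of pointed coalgebras -/

/-- A minimal nonzero subspace of a pointed coalgebra that is stable under the action
`x ↦ a(x₁) x₂` is spanned by a group-like element.

The right translates of such a subspace `M` span a finite-dimensional subcoalgebra, which contains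
a group-like element `g = ∑ i, hitRight bᵢ mᵢ`. If the number of summands is as small as possible,
then every `a` with `a g = 0` kills `m₁`: otherwise some multiple of `a` would fix `m₁`, and
subtracting its action would give a shorter expression for `g`. Hence `Δ m₁ = g ⊗ m₁`. -/
lemma IsPointedCoalgebra.exists_eq_span_isGroupLikeElem (hC : IsPointedCoalgebra k C)
    {M : Submodule k C} (hst : ∀ x ∈ M, ∀ a, hitLeft Δ a x ∈ M) (h0 : M ≠ ⊥)
    (hmin : ∀ N ≤ M, (∀ x ∈ N, ∀ a, hitLeft Δ a x ∈ N) → N ≠ ⊥ → N = M) :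
    ∃ g, IsGroupLikeElem k g ∧ M = k ∙ g := by
  have hco := Coalgebra.coassoc (R := k) (A := C)
  -- Every nonzero element of `M` generates `M`.
  have hgen : ∀ y ∈ M, y ≠ 0 → ∀ x ∈ M, ∃ c, hitLeft Δ c y = x := by
    intro y hy hy0
    let φ : Module.Dual k C →ₗ[k] C :=
      { toFun := fun c => hitLeft Δ c y
        map_add' := fun a b => by
          simp [hitLeft, evalLeft, LinearMap.rTensor_add]
        map_smul' := fun a b => by
          simp [hitLeft, evalLeft, LinearMap.rTensor_smul] }
    have : LinearMap.range φ = M := by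
      refine hmin _ ?_ ?_ ?_
      · rintro _ ⟨c, rfl⟩
        exact hst y hy c
      · rintro _ ⟨c, rfl⟩ a
        exact ⟨a ∘ₗ hitLeft Δ c, (hitLeft_hitLeft hco a c y).symm⟩
      · intro h
        apply hy0
        have : y ∈ LinearMap.range φ := ⟨Coalgebra.counit, hitLeft_counit y⟩
        simpa [h] using this
    intro x hx
    rw [← this] at hx
    exact hx
  obtain ⟨y, hy, hy0⟩ := Submodule.exists_mem_ne_zero_of_ne_bot h0
  -- The right translates of `M` span a finite-dimensional subcoalgebra `N`.
  let N : Submodule k C := ⨆ b, M.map (hitRight Δ b)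
  have hMN : M ≤ N := fun x hx => Submodule.mem_iSup_of_mem Coalgebra.counit
    ⟨x, hx, hitRight_counit x⟩
  have hNL : ∀ x ∈ N, ∀ a, hitLeft Δ a x ∈ N := by
    intro x hx a
    have : N ≤ N.comap (hitLeft Δ a) := iSup_le fun b => by
      rintro _ ⟨x, hx, rfl⟩
      rw [Submodule.mem_comap, hitLeft_hitRight hco]
      exact Submodule.mem_iSup_of_mem b (Submodule.mem_map_of_mem (hst x hx a))
    exact this hx
  have hNR : ∀ x ∈ N, ∀ a, hitRight Δ a x ∈ N := by
    intro x hx a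
    have : N ≤ N.comap (hitRight Δ a) := iSup_le fun b => by
      rintro _ ⟨x, hx, rfl⟩
      rw [Submodule.mem_comap, hitRight_hitRight hco]
      exact Submodule.mem_iSup_of_mem _ (Submodule.mem_map_of_mem hx)
    exact this hx
  have hNfd : FiniteDimensional k N := by
    obtain ⟨E, _, hE, -, -⟩ := exists_finiteDimensional_stable hco (k ∙ y)
    refine Submodule.finiteDimensional_of_le (S₂ := E) (iSup_le fun b => ?_)
    rintro _ ⟨x, hx, rfl⟩
    obtain ⟨c, rfl⟩ := hgen y hy hy0 x hx
    exact hE y (Submodule.mem_span_singleton_self y) c b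
  obtain ⟨g, hgN, hg⟩ := hC.exists_isGroupLikeElem_mem (isSubcoalgebra_iff.2 ⟨hNL, hNR⟩)
    (ne_bot_of_le_ne_bot h0 hMN)
  -- A shortest expression of `g` as a sum of right translates of elements of `M`.
  let S (l : List (Module.Dual k C × C)) : C := (l.map fun p => hitRight Δ p.1 p.2).sum
  have hex : ∃ n, ∃ l : List (Module.Dual k C × C), (∀ p ∈ l, p.2 ∈ M) ∧ S l = g ∧
      l.length = n := by
    have : ∀ x ∈ N, ∃ l : List (Module.Dual k C × C), (∀ p ∈ l, p.2 ∈ M) ∧ S l = x := by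
      intro x hx
      induction hx using Submodule.iSup_induction' with
      | mem b x hx =>
        obtain ⟨m, hm, rfl⟩ := hx
        exact ⟨[(b, m)], by simpa using hm, by simp [S]⟩
      | zero => exact ⟨[], by simp, by simp [S]⟩
      | add x y _ _ hx hy =>
        obtain ⟨l, hl, rfl⟩ := hx
        obtain ⟨l', hl', rfl⟩ := hy
        exact ⟨l ++ l', by
          simp only [List.mem_append]
          rintro p (hp | hp)
          exacts [hl p hp, hl' p hp], by simp [S]⟩
    obtain ⟨l, hl, hlg⟩ := this g hgN
    exact ⟨_, l, hl, hlg, rfl⟩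
  classical
  obtain ⟨l, hl, hlg, hn⟩ := Nat.find_spec hex
  cases l with
  | nil => exact absurd hlg.symm hg.ne_zero
  | cons p l =>
    obtain ⟨b, m⟩ := p
    have hm : m ∈ M := hl (b, m) (by simp)
    have hlg' : S l = g - hitRight Δ b m := by rw [← hlg]; simp [S]
    have hshort : ∀ l', (∀ p ∈ l', p.2 ∈ M) → S l' = g → l'.length ≠ l.length := by
      intro l' h1 h2 h3
      have := Nat.find_min' hex ⟨l', h1, h2, h3⟩
      rw [← hn] at this
      simp at this
    have hm0 : m ≠ 0 := by
      rintro rfl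
      exact hshort l (fun p hp => hl p (by simp [hp])) (by simpa using hlg') rfl
    have hkill : ∀ a : Module.Dual k C, a g = 0 → hitLeft Δ a m = 0 := by
      intro a ha
      by_contra hne
      obtain ⟨c, hcm⟩ := hgen _ (hst m hm a) hne m hm
      let d : Module.Dual k C := c ∘ₗ hitLeft Δ a
      have hdm : hitLeft Δ d m = m := by rw [← hitLeft_hitLeft hco, hcm]
      have hdg : hitLeft Δ d g = 0 := by
        rw [← hitLeft_hitLeft hco, hg.hitLeft a, ha, zero_smul, map_zero]
      have hS : ∀ l, S (l.map fun p => (p.1, p.2 - hitLeft Δ d p.2)) =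
          S l - hitLeft Δ d (S l) := by
        intro l
        induction l with
        | nil => simp [S]
        | cons p l ih =>
          simp only [S, List.map_cons, List.sum_cons, map_add, map_sub] at ih ⊢
          rw [ih, hitLeft_hitRight hco]
          abel
      refine hshort (l.map fun p => (p.1, p.2 - hitLeft Δ d p.2)) ?_ ?_ (by simp)
      · simp only [List.mem_map]
        rintro _ ⟨p, hp, rfl⟩
        have := hl p (by simp [hp])
        exact M.sub_mem this (hst _ this d)
      · rw [hS, hlg', map_sub, hdg, hitLeft_hitRight hco, hdm]
        abel
    -- `Δ m = g ⊗ m`, so that `m` is a multiple of `g`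
    have hmg : ∀ a : Module.Dual k C, hitLeft Δ a m = a g • m := by
      intro a
      have := hkill (a - a g • Coalgebra.counit) (by simp [hg.counit_eq_one])
      have h2 : hitLeft Δ (a - a g • Coalgebra.counit) m =
          hitLeft Δ a m - a g • hitLeft Δ (Coalgebra.counit (R := k)) m := by
        simp [hitLeft, evalLeft, LinearMap.rTensor_sub, LinearMap.rTensor_smul]
      rw [h2, hitLeft_counit] at this
      exact sub_eq_zero.1 this
    have hΔ : Δ m = g ⊗ₜ m := eq_of_evalLeft_eq fun a => by
      rw [← hitLeft_apply, hmg, evalLeft_tmul]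
    have hm' : m = Coalgebra.counit (R := k) m • g := by
      have := hitRight_counit (k := k) m
      rw [hitRight_apply, hΔ, evalRight_tmul] at this
      exact this.symm
    have hgM : g ∈ M := by
      have hc : Coalgebra.counit (R := k) m ≠ 0 := fun h => hm0 (by rw [hm', h, zero_smul])
      rw [hm'] at hm
      exact (M.smul_mem_iff hc).1 hm
    refine ⟨g, hg, (hmin _ (by simpa using hgM)
      (isSubcoalgebra_iff.1 hg.isSubcoalgebra_span).1 ?_).symm⟩
    simpa using hg.ne_zero

lemma coradical_stable_left (x : C) (hx : x ∈ coradical k C) (a : Module.Dual k C) :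
    hitLeft Δ a x ∈ coradical k C := by
  have : coradical k C ≤ (coradical k C).comap (hitLeft Δ a) := sSup_le fun D hD y hy =>
    Submodule.mem_sSup_of_mem hD ((isSubcoalgebra_iff.1 hD.isSubcoalgebra).1 y hy a)
  exact this hx

/-- The coradical filtration of a pointed coalgebra is exhaustive: every element is killed by all
long enough products of functionals that vanish on the coradical. -/
theorem IsPointedCoalgebra.exists_mem_hitFiltration (hC : IsPointedCoalgebra k C) (x : C) :
    ∃ n, x ∈ hitFiltration Δ {a | ∀ y ∈ coradical k C, a y = 0} n := by
  have hco := Coalgebra.coassoc (R := k) (A := C)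
  let F := hitFiltration Δ {a | ∀ y ∈ coradical k C, a y = 0}
  have hF : ∀ n, ∀ x ∈ F n, ∀ b, hitLeft Δ b x ∈ F n := by
    intro n x hx b
    cases n with
    | zero =>
      obtain rfl : x = 0 := hx
      simp
    | succ n =>
      refine mem_hitFiltration_succ.2 fun a ha => ?_
      rw [hitLeft_hitLeft hco]
      exact mem_hitFiltration_succ.1 hx _ fun y hy => ha _ (coradical_stable_left y hy b)
  obtain ⟨E, _, hWE, hEL, -⟩ := exists_finiteDimensional_stable hco (k ∙ x)
  have hxE : x ∈ E := by
    simpa using hWE x (Submodule.mem_span_singleton_self x) Coalgebra.counit Coalgebra.counit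
  obtain ⟨n, hn⟩ := WellFoundedGT.monotone_chain_condition
    (⟨fun n => (F n).comap E.subtype, fun i j hij => Submodule.comap_mono
      (hitFiltration_mono _ hij)⟩ : ℕ →o Submodule k E)
  have hn' : E ⊓ F (n + 1) ≤ F n := fun y hy => by
    have h1 : (⟨y, hy.1⟩ : E) ∈ (F (n + 1)).comap E.subtype := hy.2
    have h2 : (F n).comap E.subtype = (F (n + 1)).comap E.subtype := hn (n + 1) (Nat.le_succ n)
    rw [← h2] at h1
    exact h1
  refine ⟨n, ?_⟩
  by_contra hxn
  -- a minimal stable subspace `W'` of `E` strictly containing `W = E ⊓ F n`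
  obtain ⟨W', hW'E, ⟨hWW', hW'st⟩, hmin⟩ := Submodule.exists_minimal_of_finiteDimensional
    (fun V => E ⊓ F n < V ∧ ∀ x ∈ V, ∀ a, hitLeft Δ a x ∈ V) E
    ⟨lt_of_le_of_ne inf_le_left fun h => hxn (h.ge hxE).2, hEL⟩
  obtain ⟨y, hyW', hyW⟩ := Set.exists_of_ssubset hWW'
  obtain ⟨φ, hφy, hφ⟩ := Submodule.exists_le_ker_of_notMem hyW
  -- `θ = hitRight φ` embeds the simple module `W' / W` into the coalgebra
  have hθW : ∀ w ∈ E ⊓ F n, hitRight Δ φ w = 0 := by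
    intro w hw
    refine (Module.forall_dual_apply_eq_zero_iff k _).1 fun a => ?_
    rw [apply_hitRight]
    exact hφ ⟨hEL w hw.1 a, hF n w hw.2 a⟩
  have hθy : hitRight Δ φ y ≠ 0 := by
    intro h
    apply hφy
    rw [← counit_hitRight φ y, h, map_zero]
  obtain ⟨g, hg, hMg⟩ := hC.exists_eq_span_isGroupLikeElem (M := W'.map (hitRight Δ φ))
    (by
      rintro _ ⟨w, hw, rfl⟩ a
      rw [hitLeft_hitRight hco]
      exact Submodule.mem_map_of_mem (hW'st w hw a))
    (by
      intro h
      apply hθy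
      have : hitRight Δ φ y ∈ W'.map (hitRight Δ φ) := Submodule.mem_map_of_mem hyW'
      simpa [h] using this)
    (by
      intro N hN hNst hN0
      refine le_antisymm hN ?_
      have : W' ⊓ N.comap (hitRight Δ φ) = W' := by
        refine hmin _ inf_le_left ⟨lt_of_le_of_ne ?_ ?_, ?_⟩
        · exact le_inf hWW'.le fun w hw => by
            rw [Submodule.mem_comap, hθW w hw]; exact N.zero_mem
        · intro h
          obtain ⟨z, hz, hz0⟩ := Submodule.exists_mem_ne_zero_of_ne_bot hN0
          obtain ⟨w, hw, rfl⟩ := hN hz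
          exact hz0 (hθW w (h.ge ⟨hw, hz⟩))
        · rintro z ⟨hz, hz'⟩ a
          refine ⟨hW'st z hz a, ?_⟩
          change hitRight Δ φ (hitLeft Δ a z) ∈ N
          rw [← hitLeft_hitRight hco]
          exact hNst _ hz' a
      rintro _ ⟨w, hw, rfl⟩
      exact (this.ge hw).2)
  -- hence functionals vanishing on the coradical map `W'` into `W`
  have hker : W' ⊓ LinearMap.ker (hitRight Δ φ) ≤ E ⊓ F n := by
    by_contra hle
    have hK : ∀ x ∈ W' ⊓ LinearMap.ker (hitRight Δ φ), ∀ a,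
        hitLeft Δ a x ∈ W' ⊓ LinearMap.ker (hitRight Δ φ) := by
      rintro x ⟨hx, hx'⟩ a
      refine ⟨hW'st x hx a, ?_⟩
      change hitRight Δ φ (hitLeft Δ a x) = 0
      rw [← hitLeft_hitRight hco, LinearMap.mem_ker.1 hx', map_zero]
    have := hmin _ inf_le_left ⟨lt_of_le_of_ne (le_inf hWW'.le fun w hw => hθW w hw)
      fun h => hle h.ge, hK⟩
    exact hθy (this.ge hyW').2
  refine hyW ⟨hW'E hyW', hn' ⟨hW'E hyW', mem_hitFiltration_succ.2 fun a ha => ?_⟩⟩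
  refine (hker ⟨hW'st y hyW' a, ?_⟩).2
  change hitRight Δ φ (hitLeft Δ a y) = 0
  rw [← hitLeft_hitRight hco]
  have : hitRight Δ φ y ∈ k ∙ g := hMg ▸ Submodule.mem_map_of_mem hyW'
  obtain ⟨c, hc⟩ := Submodule.mem_span_singleton.1 this
  rw [← hc, map_smul, hg.hitLeft, ha g hg.mem_coradical, zero_smul, smul_zero]

end Counital

/-! ### Graded vector spaces -/

section Graded

variable {k ι V M : Type*} [Field k] [AddCommGroup V] [Module k V] [AddCommMonoid M] [Module k M]
  {A : ι → Submodule k V}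

lemma LinearMap.ext_of_iSup_eq_top (hA : ⨆ i, A i = ⊤) {f g : V →ₗ[k] M}
    (h : ∀ i, ∀ x ∈ A i, f x = g x) : f = g := by
  have : ⨆ i, A i ≤ LinearMap.eqLocus f g := iSup_le h
  rw [hA, top_le_iff] at this
  exact LinearMap.eqLocus_eq_top.1 this

/-- A family of subspaces that admits a family of projections is independent. -/
lemma iSupIndep_of_projection (P : ι → V →ₗ[k] V) (h1 : ∀ i, ∀ x ∈ A i, P i x = x)
    (h2 : ∀ i j, i ≠ j → ∀ x ∈ A i, P j x = 0) : iSupIndep A := by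
  intro i
  rw [Submodule.disjoint_def]
  intro x hx hx'
  have : ⨆ j, ⨆ (_ : j ≠ i), A j ≤ LinearMap.ker (P i) :=
    iSup₂_le fun j hj x hx => h2 j i hj x hx
  rw [← h1 i x hx]
  exact this hx'

variable (hind : iSupIndep A) (hsup : ⨆ i, A i = ⊤)

open Classical in
/-- The linear map on an internal direct sum `⨁ Aᵢ` that restricts to `φ i` on `Aᵢ`. -/
noncomputable def gradedLift (φ : ι → V →ₗ[k] M) : V →ₗ[k] M :=
  DirectSum.toModule k ι M (fun i => φ i ∘ₗ (A i).subtype) ∘ₗ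
    (LinearEquiv.ofBijective (DirectSum.coeLinearMap A)
      (DirectSum.isInternal_submodule_of_iSupIndep_of_iSup_eq_top hind hsup)).symm.toLinearMap

lemma gradedLift_apply (φ : ι → V →ₗ[k] M) {i : ι} {x : V} (hx : x ∈ A i) :
    gradedLift hind hsup φ x = φ i x := by
  classical
  have : (LinearEquiv.ofBijective (DirectSum.coeLinearMap A)
      (DirectSum.isInternal_submodule_of_iSupIndep_of_iSup_eq_top hind hsup)).symm x =
      DirectSum.lof k ι (fun i => A i) i ⟨x, hx⟩ := by
    rw [LinearEquiv.symm_apply_eq]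
    exact (DirectSum.coeLinearMap_lof A i ⟨x, hx⟩).symm
  simp [gradedLift, this]

open Classical in
/-- The projection of an internal direct sum onto its `i`-th summand. -/
noncomputable def gradedProj (i : ι) : V →ₗ[k] V :=
  gradedLift hind hsup fun j => if j = i then LinearMap.id else 0

lemma gradedProj_of_mem {i : ι} {x : V} (hx : x ∈ A i) : gradedProj hind hsup i x = x := by
  simp [gradedProj, gradedLift_apply hind hsup _ hx]

lemma gradedProj_of_mem_of_ne {i j : ι} (hij : i ≠ j) {x : V} (hx : x ∈ A i) :
    gradedProj hind hsup j x = 0 := by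
  simp [gradedProj, gradedLift_apply hind hsup _ hx, hij]

lemma gradedProj_mem (i : ι) (x : V) : gradedProj hind hsup i x ∈ A i := by
  have : ⨆ j, A j ≤ (A i).comap (gradedProj hind hsup i) := by
    refine iSup_le fun j y hy => ?_
    by_cases h : j = i
    · subst h
      rw [Submodule.mem_comap, gradedProj_of_mem hind hsup hy]
      exact hy
    · rw [Submodule.mem_comap, gradedProj_of_mem_of_ne hind hsup h hy]
      exact Submodule.zero_mem _
  rw [hsup] at this
  exact this trivial

/-- Every element is the sum of its homogeneous components over any large enough finite set. -/
lemma exists_sum_gradedProj (x : V) :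
    ∃ F : Finset ι, ∀ F', F ⊆ F' → ∑ i ∈ F', gradedProj hind hsup i x = x := by
  classical
  have hx : x ∈ ⨆ i, A i := hsup ▸ trivial
  induction hx using Submodule.iSup_induction' with
  | mem i x hx =>
    refine ⟨{i}, fun F' hF => ?_⟩
    rw [Finset.sum_eq_single_of_mem i (hF (Finset.mem_singleton_self i)) fun j _ hj =>
      gradedProj_of_mem_of_ne hind hsup hj.symm hx, gradedProj_of_mem hind hsup hx]
  | zero => exact ⟨∅, by simp⟩
  | add x y _ _ hx hy =>
    obtain ⟨F, hF⟩ := hx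
    obtain ⟨F', hF'⟩ := hy
    exact ⟨F ∪ F', fun S hS => by
      simp [Finset.sum_add_distrib, hF S (Finset.union_subset_left hS),
        hF' S (Finset.union_subset_right hS)]⟩

/-- A tensor all of whose bihomogeneous components lie in `T` lies in `T`. -/
lemma mem_of_gradedProj_mem {T : Submodule k (V ⊗[k] V)} {t : V ⊗[k] V}
    (h : ∀ i j, TensorProduct.map (gradedProj hind hsup i) (gradedProj hind hsup j) t ∈ T) :
    t ∈ T := by
  classical
  have key : ∃ F : Finset ι, ∀ F', F ⊆ F' → ∑ i ∈ F', ∑ j ∈ F',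
      TensorProduct.map (gradedProj hind hsup i) (gradedProj hind hsup j) t = t := by
    clear h
    induction t with
    | zero => exact ⟨∅, by simp⟩
    | tmul x y =>
      obtain ⟨F, hF⟩ := exists_sum_gradedProj hind hsup x
      obtain ⟨F', hF'⟩ := exists_sum_gradedProj hind hsup y
      refine ⟨F ∪ F', fun S hS => ?_⟩
      simp [← TensorProduct.tmul_sum, ← TensorProduct.sum_tmul,
        hF S (Finset.union_subset_left hS), hF' S (Finset.union_subset_right hS)]
    | add x y hx hy =>
      obtain ⟨F, hF⟩ := hx
      obtain ⟨F', hF'⟩ := hy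
      exact ⟨F ∪ F', fun S hS => by
        simp only [map_add, Finset.sum_add_distrib]
        rw [hF S (Finset.union_subset_left hS), hF' S (Finset.union_subset_right hS)]⟩
  obtain ⟨F, hF⟩ := key
  rw [← hF F subset_rfl]
  exact T.sum_mem fun i _ => T.sum_mem fun j _ => h i j

end Graded

/-! ### The pointed coalgebra with splitting of a reduced colored coalgebra -/

namespace ReducedColoredCoalg

variable {k : Type u} [Field k] (X : ReducedColoredCoalg k)

/-- Linear maps that agree on `ᵍCˢ ⊗ ˢCʰ` for all `s` agree on the comultiplication of `ᵍCʰ`. -/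
lemma eq_on_comul {M : Type*} [AddCommMonoid M] [Module k M]
    {φ ψ : X.carrier ⊗[k] X.carrier →ₗ[k] M} {g h : X.colors}
    (hφ : ∀ s, ∀ u ∈ X.component g s, ∀ v ∈ X.component s h, φ (u ⊗ₜ v) = ψ (u ⊗ₜ v))
    {x : X.carrier} (hx : x ∈ X.component g h) : φ (X.comul x) = ψ (X.comul x) := by
  have : (⨆ s : X.colors, LinearMap.range
      (TensorProduct.mapIncl (X.component g s) (X.component s h))) ≤ LinearMap.eqLocus φ ψ := by
    refine iSup_le fun s => ?_
    rintro _ ⟨t, rfl⟩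
    change φ _ = ψ _
    induction t with
    | zero => simp
    | add => simp_all
    | tmul u v => exact hφ s u u.2 v v.2
  exact this (X.comul_mem g h x hx)

/-- The linear map that restricts to `φ g h` on the component `ᵍCʰ`. -/
noncomputable def lift {M : Type*} [AddCommMonoid M] [Module k M]
    (φ : X.colors → X.colors → X.carrier →ₗ[k] M) : X.carrier →ₗ[k] M :=
  gradedLift X.iSupIndep_component X.iSup_component fun p => φ p.1 p.2

lemma lift_apply {M : Type*} [AddCommMonoid M] [Module k M]
    (φ : X.colors → X.colors → X.carrier →ₗ[k] M) {g h : X.colors} {x : X.carrier}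
    (hx : x ∈ X.component g h) : X.lift φ x = φ g h x :=
  gradedLift_apply X.iSupIndep_component X.iSup_component (i := (g, h)) _ hx

variable {X} in
lemma hom_ext_component {M : Type*} [AddCommMonoid M] [Module k M] {φ ψ : X.carrier →ₗ[k] M}
    (h : ∀ g h, ∀ x ∈ X.component g h, φ x = ψ x) : φ = ψ :=
  LinearMap.ext_of_iSup_eq_top X.iSup_component fun p => h p.1 p.2

/-- The vector space `kG ⊕ C` underlying the pointed coalgebra of a reduced colored coalgebra
`(C, G)`. -/
abbrev Total : Type u := (X.colors →₀ k) × X.carrier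

/-- A color, as an element of `kG ⊕ C`. -/
noncomputable def pt (g : X.colors) : X.Total := (Finsupp.single g 1, 0)

/-- The inclusion of `C` into `kG ⊕ C`. -/
noncomputable def inc : X.carrier →ₗ[k] X.Total := LinearMap.inr k (X.colors →₀ k) X.carrier

/-- The projection of `kG ⊕ C` onto `C`. -/
noncomputable def out : X.Total →ₗ[k] X.carrier := LinearMap.snd k (X.colors →₀ k) X.carrier

@[simp] lemma out_pt (g : X.colors) : X.out (X.pt g) = 0 := rfl

@[simp] lemma out_inc (x : X.carrier) : X.out (X.inc x) = x := rfl

lemma out_comp_inc : X.out ∘ₗ X.inc = LinearMap.id := rfl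

/-- The linear map on `kG ⊕ C` with given values on the colors and on `C`. -/
noncomputable def desc {M : Type*} [AddCommMonoid M] [Module k M] (i : X.colors → M)
    (f : X.carrier →ₗ[k] M) : X.Total →ₗ[k] M :=
  LinearMap.coprod (Finsupp.linearCombination k i) f

@[simp] lemma desc_pt {M : Type*} [AddCommMonoid M] [Module k M] (i : X.colors → M)
    (f : X.carrier →ₗ[k] M) (g : X.colors) : X.desc i f (X.pt g) = i g := by
  simp [desc, pt]

@[simp] lemma desc_inc {M : Type*} [AddCommMonoid M] [Module k M] (i : X.colors → M)
    (f : X.carrier →ₗ[k] M) (x : X.carrier) : X.desc i f (X.inc x) = f x := by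
  simp [desc, inc]

variable {X} in
lemma total_ext {M : Type*} [AddCommMonoid M] [Module k M] {φ ψ : X.Total →ₗ[k] M}
    (h1 : ∀ g, φ (X.pt g) = ψ (X.pt g))
    (h2 : ∀ g h, ∀ x ∈ X.component g h, φ (X.inc x) = ψ (X.inc x)) : φ = ψ := by
  refine LinearMap.prod_ext (Finsupp.lhom_ext' fun g => LinearMap.ext_ring ?_)
    (hom_ext_component h2)
  exact h1 g

/-- The comultiplication of `kG ⊕ C`: colors are group-like, and `x ∈ ᵍCʰ` is sent to
`g ⊗ x + x ⊗ h + Δ x`. -/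
noncomputable def totalComul : X.Total →ₗ[k] X.Total ⊗[k] X.Total :=
  X.desc (fun g => X.pt g ⊗ₜ X.pt g) (X.lift fun g h =>
    TensorProduct.mk k X.Total X.Total (X.pt g) ∘ₗ X.inc +
    (TensorProduct.mk k X.Total X.Total).flip (X.pt h) ∘ₗ X.inc +
    TensorProduct.map X.inc X.inc ∘ₗ X.comul)

lemma totalComul_pt (g : X.colors) : X.totalComul (X.pt g) = X.pt g ⊗ₜ X.pt g := by
  simp [totalComul]

lemma totalComul_inc {g h : X.colors} {x : X.carrier} (hx : x ∈ X.component g h) :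
    X.totalComul (X.inc x) = X.pt g ⊗ₜ X.inc x + X.inc x ⊗ₜ X.pt h +
      TensorProduct.map X.inc X.inc (X.comul x) := by
  simp [totalComul, X.lift_apply _ hx]

lemma totalComul_coassoc :
    TensorProduct.assoc k X.Total X.Total X.Total ∘ₗ X.totalComul.rTensor X.Total ∘ₗ
      X.totalComul = X.totalComul.lTensor X.Total ∘ₗ X.totalComul := by
  refine total_ext (fun g => by simp [totalComul_pt]) fun g h x hx => ?_
  -- the terms `∑ u ⊗ s ⊗ v` of both sides, where `Δ x = ∑ u ⊗ v` with `u ∈ ᵍCˢ`, `v ∈ ˢCʰ`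
  let σ : X.carrier ⊗[k] X.carrier →ₗ[k] X.Total ⊗[k] (X.Total ⊗[k] X.Total) :=
    TensorProduct.map X.inc (X.lift fun s _ =>
      TensorProduct.mk k X.Total X.Total (X.pt s) ∘ₗ X.inc)
  let τ : X.carrier ⊗[k] X.carrier →ₗ[k] X.Total ⊗[k] X.Total := TensorProduct.map X.inc X.inc
  let τ₃ : X.carrier ⊗[k] (X.carrier ⊗[k] X.carrier) →ₗ[k]
    X.Total ⊗[k] (X.Total ⊗[k] X.Total) := TensorProduct.map X.inc τ
  let α := TensorProduct.assoc k X.Total X.Total X.Total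
  have hτ₃ : ∀ (w : X.carrier ⊗[k] X.carrier) (v : X.carrier), α (τ w ⊗ₜ X.inc v) =
      τ₃ (TensorProduct.assoc k _ _ _ (w ⊗ₜ v)) := by
    intro w v
    induction w with
    | zero => simp
    | add => simp_all [TensorProduct.add_tmul]
    | tmul => simp [τ, τ₃, α]
  have hl : α (X.totalComul.rTensor X.Total (τ (X.comul x))) =
      X.pt g ⊗ₜ τ (X.comul x) + σ (X.comul x) +
        τ₃ (TensorProduct.assoc k _ _ _ (X.comul.rTensor _ (X.comul x))) := by
    refine X.eq_on_comul (φ := α.toLinearMap ∘ₗ X.totalComul.rTensor X.Total ∘ₗ τ)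
      (ψ := TensorProduct.mk k _ _ (X.pt g) ∘ₗ τ + σ +
        τ₃ ∘ₗ (TensorProduct.assoc k _ _ _).toLinearMap ∘ₗ X.comul.rTensor _)
      (fun s u hu v hv => ?_) hx
    simp only [LinearMap.add_apply, LinearMap.comp_apply, LinearEquiv.coe_coe,
      LinearMap.rTensor_tmul, ← hτ₃]
    simp only [τ, σ, TensorProduct.map_tmul, LinearMap.rTensor_tmul, X.totalComul_inc hu,
      TensorProduct.add_tmul, map_add, X.lift_apply _ hv]
    simp [α]
  have hr : X.totalComul.lTensor X.Total (τ (X.comul x)) =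
      σ (X.comul x) + α (τ (X.comul x) ⊗ₜ X.pt h) + τ₃ (X.comul.lTensor _ (X.comul x)) := by
    refine X.eq_on_comul (φ := X.totalComul.lTensor X.Total ∘ₗ τ)
      (ψ := σ + α.toLinearMap ∘ₗ (TensorProduct.mk k _ _).flip (X.pt h) ∘ₗ τ +
        τ₃ ∘ₗ X.comul.lTensor _)
      (fun s u hu v hv => ?_) hx
    simp only [LinearMap.add_apply, LinearMap.comp_apply, LinearEquiv.coe_coe]
    simp only [τ, τ₃, σ, TensorProduct.map_tmul, LinearMap.lTensor_tmul, X.totalComul_inc hv,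
      TensorProduct.tmul_add, X.lift_apply _ hv]
    simp [α]
  have hco := LinearMap.congr_fun X.coassoc x
  simp only [LinearMap.comp_apply, LinearEquiv.coe_coe] at hco ⊢
  change α _ = _
  rw [X.totalComul_inc hx]
  simp only [map_add, LinearMap.rTensor_tmul, LinearMap.lTensor_tmul, X.totalComul_pt,
    X.totalComul_inc hx, TensorProduct.add_tmul, TensorProduct.tmul_add]
  change _ + (_ + _ + α (τ (X.comul x) ⊗ₜ X.pt h)) + α (X.totalComul.rTensor X.Total
    (τ (X.comul x))) = _ + _ + X.pt g ⊗ₜ τ (X.comul x) + _ +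
      X.totalComul.lTensor X.Total (τ (X.comul x))
  rw [hl, hr, hco]
  simp only [α, TensorProduct.assoc_tmul]
  abel

noncomputable instance : Coalgebra k X.Total where
  comul := X.totalComul
  counit := X.desc (fun _ => 1) 0
  coassoc := X.totalComul_coassoc
  rTensor_counit_comp_comul := by
    refine total_ext (fun g => by simp [totalComul_pt]) fun g h x hx => ?_
    have : (X.desc (fun _ => (1 : k)) 0) ∘ₗ X.inc = 0 := by ext; simp
    rw [LinearMap.comp_apply, X.totalComul_inc hx, map_add, map_add, ← LinearMap.comp_apply,
      ← LinearMap.comp_apply, LinearMap.rTensor_comp_map, this]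
    simp
  lTensor_counit_comp_comul := by
    refine total_ext (fun g => by simp [totalComul_pt]) fun g h x hx => ?_
    have : (X.desc (fun _ => (1 : k)) 0) ∘ₗ X.inc = 0 := by ext; simp
    rw [LinearMap.comp_apply, X.totalComul_inc hx, map_add, map_add, ← LinearMap.comp_apply,
      ← LinearMap.comp_apply, LinearMap.lTensor_comp_map, this]
    simp

lemma comul_pt (g : X.colors) :
    Coalgebra.comul (R := k) (X.pt g) = X.pt g ⊗ₜ X.pt g := X.totalComul_pt g

lemma comul_inc {g h : X.colors} {x : X.carrier} (hx : x ∈ X.component g h) :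
    Coalgebra.comul (R := k) (X.inc x) = X.pt g ⊗ₜ X.inc x + X.inc x ⊗ₜ X.pt h +
      TensorProduct.map X.inc X.inc (X.comul x) := X.totalComul_inc hx

@[simp] lemma counit_pt (g : X.colors) : Coalgebra.counit (R := k) (X.pt g) = 1 :=
  X.desc_pt _ _ g

@[simp] lemma counit_inc (x : X.carrier) : Coalgebra.counit (R := k) (X.inc x) = 0 :=
  X.desc_inc _ _ x

/-- The projection of `kG ⊕ C` onto `C` preserves the comultiplications. -/
lemma comul_out (y : X.Total) :
    X.comul (X.out y) = TensorProduct.map X.out X.out (Coalgebra.comul (R := k) y) := by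
  refine LinearMap.congr_fun (f := X.comul ∘ₗ X.out) (g := TensorProduct.map X.out X.out ∘ₗ
    Coalgebra.comul) (total_ext (fun g => by simp [comul_pt]) fun g h x hx => ?_) y
  simp only [LinearMap.comp_apply, X.comul_inc hx, map_add, TensorProduct.map_tmul, out_pt,
    TensorProduct.zero_tmul, TensorProduct.tmul_zero, zero_add, out_inc]
  rw [← LinearMap.comp_apply, ← TensorProduct.map_comp, out_comp_inc]
  simp

lemma isGroupLikeElem_pt (g : X.colors) : IsGroupLikeElem k (X.pt g) :=
  ⟨X.counit_pt g, X.comul_pt g⟩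

lemma pt_injective : Function.Injective X.pt := fun g h hgh => by
  have := congrArg Prod.fst hgh
  exact Finsupp.single_left_injective one_ne_zero this

/-- The functional on `kG ⊕ C` that reads off the coefficient of a color. -/
noncomputable def coeff (g : X.colors) : Module.Dual k X.Total :=
  Finsupp.lapply g ∘ₗ LinearMap.fst k (X.colors →₀ k) X.carrier

@[simp] lemma coeff_inc (g : X.colors) (x : X.carrier) : X.coeff g (X.inc x) = 0 := rfl

@[simp] lemma coeff_pt_self (g : X.colors) : X.coeff g (X.pt g) = 1 := by
  simp [coeff, pt]

lemma coeff_pt_of_ne {g h : X.colors} (hgh : h ≠ g) : X.coeff g (X.pt h) = 0 := by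
  simp [coeff, pt, Finsupp.single_eq_of_ne hgh.symm]

lemma hitLeft_inc {g h : X.colors} {x : X.carrier} (hx : x ∈ X.component g h)
    (a : Module.Dual k X.Total) (ha : ∀ x, a (X.inc x) = 0) :
    hitLeft Coalgebra.comul a (X.inc x) = a (X.pt g) • X.inc x := by
  have : a ∘ₗ X.inc = 0 := LinearMap.ext ha
  simp [hitLeft_apply, X.comul_inc hx, evalLeft_map, ha, this]
  simp [evalLeft]

lemma hitRight_inc {g h : X.colors} {x : X.carrier} (hx : x ∈ X.component g h)
    (a : Module.Dual k X.Total) (ha : ∀ x, a (X.inc x) = 0) :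
    hitRight Coalgebra.comul a (X.inc x) = a (X.pt h) • X.inc x := by
  have : a ∘ₗ X.inc = 0 := LinearMap.ext ha
  simp [hitRight_apply, X.comul_inc hx, evalRight_map, ha, this]
  simp [evalRight]

/-- A nonzero subcoalgebra of `kG ⊕ C` contains a color: acting by functionals that vanish on the
colors lowers the degree of conilpotency of the component in `C`. -/
lemma exists_pt_mem {D : Submodule k X.Total} (hD : IsSubcoalgebra k D) (h0 : D ≠ ⊥) :
    ∃ g, X.pt g ∈ D := by
  have key : ∀ n, ∀ y ∈ D, y ≠ 0 → X.out y ∈ hitFiltration X.comul Set.univ n →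
      ∃ g, X.pt g ∈ D := by
    intro n
    induction n with
    | zero =>
      intro y hy hy0 hn
      have hn' : y.2 = 0 := hn
      obtain ⟨g, hg⟩ : ∃ g, y.1 g ≠ 0 := by
        by_contra! h
        exact hy0 (Prod.ext (Finsupp.ext h) hn')
      have hhit : ∀ v : X.colors →₀ k, hitLeft Coalgebra.comul (X.coeff g) (v, 0) =
          v g • X.pt g := by
        intro v
        refine LinearMap.congr_fun (f := hitLeft Coalgebra.comul (X.coeff g) ∘ₗ
          LinearMap.inl k _ _) (g := (LinearMap.toSpanSingleton k _ (X.pt g)) ∘ₗ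
          Finsupp.lapply g) (Finsupp.lhom_ext' fun h => LinearMap.ext_ring ?_) v
        change hitLeft Coalgebra.comul (X.coeff g) (X.pt h) =
          (Finsupp.single h (1 : k) g) • X.pt g
        rw [(X.isGroupLikeElem_pt h).hitLeft]
        by_cases hh : h = g
        · subst hh
          simp
        · rw [X.coeff_pt_of_ne hh, Finsupp.single_eq_of_ne (Ne.symm hh), zero_smul, zero_smul]
      have := (isSubcoalgebra_iff.1 hD).1 y hy (X.coeff g)
      obtain ⟨v, x⟩ := y
      obtain rfl : x = 0 := hn'
      rw [hhit] at this
      exact ⟨g, (D.smul_mem_iff hg).1 this⟩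
    | succ n ih =>
      intro y hy hy0 hn
      by_cases h2 : X.out y = 0
      · exact ih y hy hy0 (h2 ▸ Submodule.zero_mem _)
      · obtain ⟨b, hb⟩ : ∃ b : Module.Dual k X.carrier, b (X.out y) ≠ 0 := by
          by_contra! h
          exact h2 ((Module.forall_dual_apply_eq_zero_iff k _).1 h)
        refine ih (hitLeft Coalgebra.comul (b ∘ₗ X.out) y)
          ((isSubcoalgebra_iff.1 hD).1 y hy _) (fun h => hb ?_) ?_
        · rw [← LinearMap.comp_apply b, ← hitRight_counit (k := k) y, apply_hitRight, h, map_zero]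
        · rw [← hitLeft_map (X.comul_out y)]
          exact mem_hitFiltration_succ.1 hn b trivial
  obtain ⟨y, hy, hy0⟩ := Submodule.exists_mem_ne_zero_of_ne_bot h0
  obtain ⟨n, hn⟩ := X.conilpotent y.2
  exact key n y hy hy0 ((ker_iteratedComul _ _ _).1 hn)

lemma isPointedCoalgebra_total : IsPointedCoalgebra k X.Total := by
  intro D hD
  obtain ⟨g, hg⟩ := X.exists_pt_mem hD.isSubcoalgebra hD.ne_bot
  have hp := X.isGroupLikeElem_pt g
  obtain h | h := hD.eq_bot_or_eq _ hp.isSubcoalgebra_span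
    ((Submodule.span_singleton_le_iff_mem _ _).2 hg)
  · exact absurd (Submodule.span_singleton_eq_bot.1 h) hp.ne_zero
  · rw [← h]
    exact finrank_span_singleton hp.ne_zero

lemma exists_eq_pt {y : X.Total} (hy : IsGroupLikeElem k y) : ∃ g, y = X.pt g := by
  obtain ⟨g, hg⟩ := X.exists_pt_mem hy.isSubcoalgebra_span (by simpa using hy.ne_zero)
  obtain ⟨c, hc⟩ := Submodule.mem_span_singleton.1 hg
  have := congrArg (Coalgebra.counit (R := k)) hc
  rw [map_smul, hy.counit_eq_one, counit_pt, smul_eq_mul, mul_one] at this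
  exact ⟨g, by rw [← hc, this, one_smul]⟩

/-- The projection of `kG ⊕ C` onto `kG`, as a coalgebra endomorphism. -/
noncomputable def totalSplit : X.Total →ₗc[k] X.Total where
  __ := X.desc X.pt 0
  counit_comp := total_ext (fun g => by simp) fun g h x _ => by simp
  map_comp_comul := by
    have : X.desc X.pt 0 ∘ₗ X.inc = 0 := by ext : 1; simp
    refine total_ext (fun g => by simp [comul_pt]) fun g h x hx => ?_
    simp only [LinearMap.comp_apply, X.comul_inc hx, map_add, TensorProduct.map_tmul, desc_inc]
    rw [← LinearMap.comp_apply (TensorProduct.map _ _), ← TensorProduct.map_comp, this]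
    simp

@[simp] lemma totalSplit_pt (g : X.colors) : X.totalSplit (X.pt g) = X.pt g :=
  X.desc_pt _ _ g

@[simp] lemma totalSplit_inc (x : X.carrier) : X.totalSplit (X.inc x) = 0 :=
  X.desc_inc _ _ x

lemma coradical_total : coradical k X.Total = Submodule.span k (Set.range X.pt) := by
  rw [coradical_eq_span X.isPointedCoalgebra_total]
  congr 1
  ext y
  refine ⟨fun hy => ?_, ?_⟩
  · obtain ⟨g, rfl⟩ := X.exists_eq_pt hy
    exact ⟨g, rfl⟩
  · rintro ⟨g, rfl⟩
    exact X.isGroupLikeElem_pt g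

/-- The pointed coalgebra with splitting `kG ⊕ C → kG` of a reduced colored coalgebra. -/
noncomputable def total : PointedSplitCoalg k where
  carrier := X.Total
  pointed := X.isPointedCoalgebra_total
  split := X.totalSplit
  range_split := by
    rw [coradical_total]
    refine le_antisymm ?_ (Submodule.span_le.2 ?_)
    · change LinearMap.range (X.desc X.pt 0) ≤ _
      rw [desc, LinearMap.range_coprod, Finsupp.range_linearCombination]
      simp
    · rintro _ ⟨g, rfl⟩
      exact ⟨X.pt g, X.totalSplit_pt g⟩
  split_apply x hx := by
    rw [coradical_total] at hx
    have : Submodule.span k (Set.range X.pt) ≤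
        LinearMap.eqLocus X.totalSplit.toLinearMap LinearMap.id := by
      rw [Submodule.span_le]
      rintro _ ⟨g, rfl⟩
      exact X.totalSplit_pt g
    exact this hx

end ReducedColoredCoalg

/-! ### Coassociativity and comultiplicative maps -/

section CoassocMap

variable {k : Type*} [Field k] {C D : Type*} [AddCommGroup C] [Module k C] [AddCommGroup D]
  [Module k D] {Δ : C →ₗ[k] C ⊗[k] C} {Δ' : D →ₗ[k] D ⊗[k] D} {f : C →ₗ[k] D}
  (hf : ∀ x, Δ' (f x) = TensorProduct.map f f (Δ x))
include hf

lemma assoc_rTensor_comul_map (x : C) :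
    TensorProduct.assoc k D D D (Δ'.rTensor D (Δ' (f x))) =
      TensorProduct.map f (TensorProduct.map f f)
        (TensorProduct.assoc k C C C (Δ.rTensor C (Δ x))) := by
  have h1 : Δ' ∘ₗ f = TensorProduct.map f f ∘ₗ Δ := LinearMap.ext hf
  rw [hf, ← LinearMap.comp_apply (Δ'.rTensor D), LinearMap.rTensor_comp_map, h1]
  generalize Δ x = t
  induction t with
  | zero => simp
  | add => simp_all
  | tmul u v =>
    simp only [TensorProduct.map_tmul, LinearMap.comp_apply, LinearMap.rTensor_tmul]
    generalize Δ u = s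
    induction s with
    | zero => simp
    | add => simp_all [TensorProduct.add_tmul]
    | tmul => simp

lemma lTensor_comul_map (x : C) :
    Δ'.lTensor D (Δ' (f x)) =
      TensorProduct.map f (TensorProduct.map f f) (Δ.lTensor C (Δ x)) := by
  have h1 : Δ' ∘ₗ f = TensorProduct.map f f ∘ₗ Δ := LinearMap.ext hf
  rw [hf, ← LinearMap.comp_apply (Δ'.lTensor D), LinearMap.lTensor_comp_map, h1,
    ← LinearMap.map_comp_lTensor]
  rfl

lemma coassoc_apply_map
    (h : TensorProduct.assoc k C C C ∘ₗ Δ.rTensor C ∘ₗ Δ = Δ.lTensor C ∘ₗ Δ) (x : C) :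
    TensorProduct.assoc k D D D (Δ'.rTensor D (Δ' (f x))) = Δ'.lTensor D (Δ' (f x)) := by
  rw [assoc_rTensor_comul_map hf, lTensor_comul_map hf]
  exact congrArg _ (LinearMap.congr_fun h x)

end CoassocMap

/-! ### The reduced colored coalgebra of a pointed coalgebra with splitting -/

namespace PointedSplitCoalg

variable {k : Type u} [Field k] (C : PointedSplitCoalg k)

local notation "Δ" => (Coalgebra.comul (R := k) (A := C.carrier))

/-- The set of group-like elements of a pointed coalgebra. -/
abbrev Points : Type u := {g : C.carrier // IsGroupLikeElem k g}

lemma linearIndependent_points : LinearIndependent k (Subtype.val : C.Points → C.carrier) :=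
  linearIndepOn_isGroupLikeElem

lemma split_mem (c : C.carrier) : C.split c ∈ coradical k C.carrier := by
  rw [← C.range_split]
  exact ⟨c, rfl⟩

lemma split_split (c : C.carrier) : C.split (C.split c) = C.split c :=
  C.split_apply _ (C.split_mem c)

lemma split_mem_span (c : C.carrier) :
    C.split.toLinearMap c ∈ Submodule.span k (Set.range (Subtype.val : C.Points → C.carrier)) := by
  have : Set.range (Subtype.val : C.Points → C.carrier) = {g | IsGroupLikeElem k g} :=
    Subtype.range_val
  rw [this, ← coradical_eq_span C.pointed]
  exact C.split_mem c

@[simp] lemma split_point (g : C.Points) : C.split g.1 = g.1 :=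
  C.split_apply _ g.2.mem_coradical

/-- Linear maps that factor through the splitting are determined by their values on group-like
elements. -/
lemma ext_of_split {M : Type*} [AddCommMonoid M] [Module k M] {φ ψ : C.carrier →ₗ[k] M}
    (hφ : ∀ c, φ (C.split c) = φ c) (hψ : ∀ c, ψ (C.split c) = ψ c)
    (h : ∀ g : C.Points, φ g.1 = ψ g.1) : φ = ψ := by
  ext c
  rw [← hφ, ← hψ]
  have : Submodule.span k (Set.range (Subtype.val : C.Points → C.carrier)) ≤
      LinearMap.eqLocus φ ψ := by
    rw [Submodule.span_le]
    rintro _ ⟨g, rfl⟩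
    exact h g
  exact this (C.split_mem_span c)

/-- The coordinates of `δ c` with respect to the basis of the coradical given by the group-like
elements. -/
noncomputable def coord : C.carrier →ₗ[k] C.Points →₀ k :=
  C.linearIndependent_points.repr ∘ₗ C.split.toLinearMap.codRestrict _ C.split_mem_span

lemma linearCombination_coord (c : C.carrier) :
    Finsupp.linearCombination k Subtype.val (C.coord c) = C.split c :=
  C.linearIndependent_points.linearCombination_repr _

lemma coord_split (c : C.carrier) : C.coord (C.split c) = C.coord c := by
  apply C.linearIndependent_points
  rw [linearCombination_coord, linearCombination_coord, split_split]

@[simp] lemma coord_point (g : C.Points) : C.coord g.1 = Finsupp.single g 1 := by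
  apply C.linearIndependent_points
  rw [linearCombination_coord, split_point, Finsupp.linearCombination_single, one_smul]

/-- The functional `c ↦ (coefficient of g in δ c)`. -/
noncomputable def coeff (g : C.Points) : Module.Dual k C.carrier := Finsupp.lapply g ∘ₗ C.coord

lemma coeff_split (g : C.Points) (c : C.carrier) : C.coeff g (C.split c) = C.coeff g c := by
  simp [coeff, coord_split]

@[simp] lemma coeff_self (g : C.Points) : C.coeff g g.1 = 1 := by simp [coeff]

lemma coeff_of_ne {g h : C.Points} (hgh : g ≠ h) : C.coeff g h.1 = 0 := by
  simp [coeff, Finsupp.single_eq_of_ne hgh]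

lemma counit_split (c : C.carrier) :
    Coalgebra.counit (R := k) (C.split c) = Coalgebra.counit (R := k) c :=
  CoalgHomClass.counit_comp_apply C.split c

lemma comul_split (c : C.carrier) :
    Δ (C.split.toLinearMap c) = TensorProduct.map C.split.toLinearMap C.split.toLinearMap (Δ c) :=
  (CoalgHomClass.map_comp_comul_apply C.split c).symm

lemma split_hitLeft (a : Module.Dual k C.carrier) (ha : ∀ c, a (C.split c) = a c) (c : C.carrier) :
    C.split (hitLeft Δ a c) = hitLeft Δ a (C.split c) := by
  have := hitLeft_map (C.comul_split c) a
  have h2 : a ∘ₗ C.split.toLinearMap = a := LinearMap.ext ha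
  rw [h2] at this
  exact this.symm

lemma split_hitRight (a : Module.Dual k C.carrier) (ha : ∀ c, a (C.split c) = a c)
    (c : C.carrier) : C.split (hitRight Δ a c) = hitRight Δ a (C.split c) := by
  have := hitRight_map (C.comul_split c) a
  have h2 : a ∘ₗ C.split.toLinearMap = a := LinearMap.ext ha
  rw [h2] at this
  exact this.symm

/-- The idempotent `c ↦ coeff g c₁ • c₂`, which projects onto the left `g`-component. -/
noncomputable abbrev rowProj (g : C.Points) : C.carrier →ₗ[k] C.carrier := hitLeft Δ (C.coeff g)

/-- The idempotent `c ↦ coeff h c₂ • c₁`, which projects onto the right `h`-component. -/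
noncomputable abbrev colProj (h : C.Points) : C.carrier →ₗ[k] C.carrier := hitRight Δ (C.coeff h)

lemma rowProj_split (g : C.Points) (c : C.carrier) :
    C.rowProj g (C.split c) = C.split (C.rowProj g c) :=
  (C.split_hitLeft _ (C.coeff_split g) c).symm

lemma colProj_split (g : C.Points) (c : C.carrier) :
    C.colProj g (C.split c) = C.split (C.colProj g c) :=
  (C.split_hitRight _ (C.coeff_split g) c).symm

lemma rowProj_colProj (g h : C.Points) (c : C.carrier) :
    C.rowProj g (C.colProj h c) = C.colProj h (C.rowProj g c) :=
  hitLeft_hitRight Coalgebra.coassoc _ _ c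

lemma hitLeft_rowProj (a : Module.Dual k C.carrier) (ha : ∀ c, a (C.split c) = a c)
    (g : C.Points) (c : C.carrier) : hitLeft Δ a (C.rowProj g c) = a g.1 • C.rowProj g c := by
  have : a ∘ₗ C.rowProj g = a g.1 • C.coeff g := by
    refine C.ext_of_split (fun c => ?_) (fun c => ?_) fun s => ?_
    · simp only [LinearMap.comp_apply]
      rw [rowProj_split, ha]
    · simp [coeff_split]
    · simp only [LinearMap.comp_apply, rowProj, s.2.hitLeft, LinearMap.smul_apply, map_smul]
      by_cases h : g = s
      · subst h; simp
      · simp [C.coeff_of_ne h]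
  rw [rowProj, hitLeft_hitLeft Coalgebra.coassoc, this]
  simp [hitLeft, evalLeft, LinearMap.rTensor_smul]

lemma hitRight_colProj (a : Module.Dual k C.carrier) (ha : ∀ c, a (C.split c) = a c)
    (g : C.Points) (c : C.carrier) : hitRight Δ a (C.colProj g c) = a g.1 • C.colProj g c := by
  have : a ∘ₗ C.colProj g = a g.1 • C.coeff g := by
    refine C.ext_of_split (fun c => ?_) (fun c => ?_) fun s => ?_
    · simp only [LinearMap.comp_apply]
      rw [colProj_split, ha]
    · simp [coeff_split]
    · simp only [LinearMap.comp_apply, colProj, s.2.hitRight, LinearMap.smul_apply, map_smul]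
      by_cases h : g = s
      · subst h; simp
      · simp [C.coeff_of_ne h]
  rw [colProj, hitRight_hitRight Coalgebra.coassoc, this]
  simp [hitRight, evalRight, LinearMap.lTensor_smul]

lemma rowProj_rowProj (g : C.Points) (c : C.carrier) :
    C.rowProj g (C.rowProj g c) = C.rowProj g c := by
  rw [C.hitLeft_rowProj _ (C.coeff_split g), coeff_self, one_smul]

lemma rowProj_rowProj_of_ne {g h : C.Points} (hgh : g ≠ h) (c : C.carrier) :
    C.rowProj g (C.rowProj h c) = 0 := by
  rw [C.hitLeft_rowProj _ (C.coeff_split g), C.coeff_of_ne hgh, zero_smul]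

lemma colProj_colProj (g : C.Points) (c : C.carrier) :
    C.colProj g (C.colProj g c) = C.colProj g c := by
  rw [C.hitRight_colProj _ (C.coeff_split g), coeff_self, one_smul]

lemma colProj_colProj_of_ne {g h : C.Points} (hgh : g ≠ h) (c : C.carrier) :
    C.colProj g (C.colProj h c) = 0 := by
  rw [C.hitRight_colProj _ (C.coeff_split g), C.coeff_of_ne hgh, zero_smul]

lemma sum_coeff (c : C.carrier) {F : Finset C.Points} (hF : (C.coord c).support ⊆ F) :
    ∑ g ∈ F, C.coeff g c = Coalgebra.counit (R := k) c := by
  rw [← counit_split, ← linearCombination_coord, Finsupp.linearCombination_apply,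
    Finsupp.sum_of_support_subset _ hF _ (by simp), map_sum]
  refine Finset.sum_congr rfl fun g _ => ?_
  rw [map_smul, g.2.counit_eq_one, smul_eq_mul, mul_one]
  rfl

lemma exists_sum_rowProj (c : C.carrier) : ∃ F : Finset C.Points, ∑ g ∈ F, C.rowProj g c = c := by
  classical
  have key : ∀ t : C.carrier ⊗[k] C.carrier, ∃ F : Finset C.Points, ∀ F', F ⊆ F' →
      ∑ g ∈ F', evalLeft (C.coeff g) t = evalLeft (Coalgebra.counit (R := k)) t := by
    intro t
    induction t with
    | zero => exact ⟨∅, by simp⟩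
    | tmul x y => exact ⟨(C.coord x).support, fun F' hF => by
        simp [← Finset.sum_smul, C.sum_coeff x hF]⟩
    | add x y hx hy =>
      obtain ⟨F, hF⟩ := hx
      obtain ⟨F', hF'⟩ := hy
      exact ⟨F ∪ F', fun S hS => by
        simp only [map_add, Finset.sum_add_distrib]
        rw [hF S (Finset.union_subset_left hS), hF' S (Finset.union_subset_right hS)]⟩
  obtain ⟨F, hF⟩ := key (Δ c)
  exact ⟨F, (hF F subset_rfl).trans (hitLeft_counit c)⟩

lemma exists_sum_colProj (c : C.carrier) : ∃ F : Finset C.Points, ∑ g ∈ F, C.colProj g c = c := by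
  classical
  have key : ∀ t : C.carrier ⊗[k] C.carrier, ∃ F : Finset C.Points, ∀ F', F ⊆ F' →
      ∑ g ∈ F', evalRight (C.coeff g) t = evalRight (Coalgebra.counit (R := k)) t := by
    intro t
    induction t with
    | zero => exact ⟨∅, by simp⟩
    | tmul x y => exact ⟨(C.coord y).support, fun F' hF => by
        simp [← Finset.sum_smul, C.sum_coeff y hF]⟩
    | add x y hx hy =>
      obtain ⟨F, hF⟩ := hx
      obtain ⟨F', hF'⟩ := hy
      exact ⟨F ∪ F', fun S hS => by
        simp only [map_add, Finset.sum_add_distrib]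
        rw [hF S (Finset.union_subset_left hS), hF' S (Finset.union_subset_right hS)]⟩
  obtain ⟨F, hF⟩ := key (Δ c)
  exact ⟨F, (hF F subset_rfl).trans (hitRight_counit c)⟩

/-- The kernel of the splitting. -/
abbrev Kernel : Submodule k C.carrier := LinearMap.ker C.split.toLinearMap

lemma split_kernel (x : C.Kernel) : C.split x.1 = 0 := x.2

/-- The projection `c ↦ c - δ c` onto the kernel of the splitting. -/
noncomputable def reduce : C.carrier →ₗ[k] C.Kernel :=
  (LinearMap.id - C.split.toLinearMap).codRestrict _ fun c => by
    change C.split (c - C.split c) = 0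
    rw [map_sub, split_split, sub_self]

lemma coe_reduce (c : C.carrier) : (C.reduce c : C.carrier) = c - C.split c := rfl

@[simp] lemma reduce_coe (x : C.Kernel) : C.reduce x.1 = x :=
  Subtype.ext (by rw [coe_reduce, split_kernel, sub_zero])

lemma reduce_split (c : C.carrier) : C.reduce (C.split c) = 0 :=
  Subtype.ext (by rw [coe_reduce, split_split, sub_self]; rfl)

/-- The comultiplication induced on the kernel of the splitting, viewed as the quotient of the
coalgebra by its coradical. -/
noncomputable def reducedComul : C.Kernel →ₗ[k] C.Kernel ⊗[k] C.Kernel :=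
  TensorProduct.map C.reduce C.reduce ∘ₗ Δ ∘ₗ C.Kernel.subtype

lemma reducedComul_reduce (c : C.carrier) :
    C.reducedComul (C.reduce c) = TensorProduct.map C.reduce C.reduce (Δ c) := by
  have h : C.reduce ∘ₗ C.split.toLinearMap = 0 := LinearMap.ext C.reduce_split
  change TensorProduct.map C.reduce C.reduce (Δ (c - C.split.toLinearMap c)) = _
  rw [map_sub, map_sub, comul_split, ← LinearMap.comp_apply (TensorProduct.map _ _)
    (TensorProduct.map _ _), ← TensorProduct.map_comp, h]
  simp

/-- The component `ᵍCʰ` of the kernel of the splitting: the elements `x` with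
`Δ x ≡ g ⊗ x` modulo `ker δ ⊗ C` and `Δ x ≡ x ⊗ h` modulo `C ⊗ ker δ`. -/
noncomputable def kernelComponent (g h : C.Points) : Submodule k C.Kernel :=
  LinearMap.eqLocus (C.rowProj g ∘ₗ C.Kernel.subtype) C.Kernel.subtype ⊓
    LinearMap.eqLocus (C.colProj h ∘ₗ C.Kernel.subtype) C.Kernel.subtype

lemma mem_kernelComponent {g h : C.Points} {x : C.Kernel} :
    x ∈ C.kernelComponent g h ↔ C.rowProj g x.1 = x.1 ∧ C.colProj h x.1 = x.1 := Iff.rfl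

/-- The projection of the kernel of the splitting onto its component `ᵍCʰ`. -/
noncomputable def kernelProj (g h : C.Points) : C.Kernel →ₗ[k] C.Kernel :=
  C.reduce ∘ₗ C.rowProj g ∘ₗ C.colProj h ∘ₗ C.Kernel.subtype

lemma coe_kernelProj (g h : C.Points) (x : C.Kernel) :
    (C.kernelProj g h x : C.carrier) = C.rowProj g (C.colProj h x.1) := by
  change (C.reduce (C.rowProj g (C.colProj h x.1)) : C.carrier) = _
  rw [coe_reduce, ← rowProj_split, ← colProj_split, split_kernel, map_zero, map_zero, sub_zero]

lemma kernelProj_mem (g h : C.Points) (x : C.Kernel) :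
    C.kernelProj g h x ∈ C.kernelComponent g h := by
  rw [mem_kernelComponent, coe_kernelProj, rowProj_rowProj, ← rowProj_colProj, colProj_colProj]
  exact ⟨rfl, rfl⟩

lemma kernelProj_of_mem {g h : C.Points} {x : C.Kernel} (hx : x ∈ C.kernelComponent g h) :
    C.kernelProj g h x = x := by
  rw [mem_kernelComponent] at hx
  exact Subtype.ext (by rw [coe_kernelProj, hx.2, hx.1])

lemma kernelProj_of_mem_of_ne {p q : C.Points × C.Points} (hpq : p ≠ q) {x : C.Kernel}
    (hx : x ∈ C.kernelComponent p.1 p.2) : C.kernelProj q.1 q.2 x = 0 := by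
  rw [mem_kernelComponent] at hx
  refine Subtype.ext ?_
  rw [coe_kernelProj]
  by_cases h2 : p.2 = q.2
  · have h1 : q.1 ≠ p.1 := fun h1 => hpq (Prod.ext h1.symm h2)
    rw [← h2, hx.2, ← hx.1, rowProj_rowProj_of_ne C h1]
    rfl
  · rw [← hx.2, colProj_colProj_of_ne C (Ne.symm h2), map_zero]
    rfl

lemma iSupIndep_kernelComponent :
    iSupIndep fun p : C.Points × C.Points => C.kernelComponent p.1 p.2 :=
  iSupIndep_of_projection (fun p => C.kernelProj p.1 p.2) (fun _ _ hx => C.kernelProj_of_mem hx)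
    fun _ _ hpq _ hx => C.kernelProj_of_mem_of_ne hpq hx

lemma iSup_kernelComponent :
    ⨆ p : C.Points × C.Points, C.kernelComponent p.1 p.2 = ⊤ := by
  refine eq_top_iff.2 fun x _ => ?_
  obtain ⟨F, hF⟩ := C.exists_sum_colProj x.1
  choose S hS using fun h => C.exists_sum_rowProj (C.colProj h x.1)
  have : x = ∑ h ∈ F, ∑ g ∈ S h, C.kernelProj g h x := Subtype.ext <| by
    simp only [AddSubmonoidClass.coe_finsetSum, coe_kernelProj, hS, hF]
  rw [this]
  exact Submodule.sum_mem _ fun h _ => Submodule.sum_mem _ fun g _ =>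
    Submodule.mem_iSup_of_mem (g, h) (C.kernelProj_mem g h x)

lemma kernelProj_reduce (g h : C.Points) (c : C.carrier) :
    C.kernelProj g h (C.reduce c) = C.reduce (C.colProj h (C.rowProj g c)) := by
  change C.reduce (C.rowProj g (C.colProj h (c - C.split c))) = _
  rw [map_sub, map_sub, colProj_split, rowProj_split, map_sub, reduce_split, sub_zero,
    rowProj_colProj]

/-- The `(ᵖCˢ ⊗ ᵗCʰ)`-component of the comultiplication vanishes for `s ≠ t` because, by
coassociativity, `colProj s ⊗ 1` and `1 ⊗ rowProj s` agree on the image of `Δ`. -/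
lemma reducedComul_mem (g h : C.Points) (x : C.Kernel) (hx : x ∈ C.kernelComponent g h) :
    C.reducedComul x ∈ ⨆ s, LinearMap.range
      (TensorProduct.mapIncl (C.kernelComponent g s) (C.kernelComponent s h)) := by
  have hproj : ∀ p : C.Points × C.Points, gradedProj C.iSupIndep_kernelComponent
      C.iSup_kernelComponent p = C.kernelProj p.1 p.2 := by
    intro p
    refine LinearMap.ext_of_iSup_eq_top C.iSup_kernelComponent fun q x hx => ?_
    by_cases hqp : q = p
    · subst hqp
      rw [C.kernelProj_of_mem hx]
      exact gradedProj_of_mem C.iSupIndep_kernelComponent C.iSup_kernelComponent hx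
    · rw [C.kernelProj_of_mem_of_ne hqp hx]
      exact gradedProj_of_mem_of_ne C.iSupIndep_kernelComponent C.iSup_kernelComponent hqp hx
  refine mem_of_gradedProj_mem C.iSupIndep_kernelComponent C.iSup_kernelComponent fun p q => ?_
  rw [hproj, hproj]
  obtain ⟨p₁, p₂⟩ := p
  obtain ⟨q₁, q₂⟩ := q
  rw [mem_kernelComponent] at hx
  have hco := Coalgebra.coassoc (R := k) (A := C.carrier)
  have hcomp : TensorProduct.map (C.kernelProj p₁ p₂) (C.kernelProj q₁ q₂) (C.reducedComul x) =
      TensorProduct.map C.reduce C.reduce ((C.rowProj q₁).lTensor _ ((C.colProj p₂).rTensor _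
        ((C.rowProj p₁).rTensor _ ((C.colProj q₂).lTensor _ (Δ x.1))))) := by
    change TensorProduct.map _ _ (TensorProduct.map C.reduce C.reduce (Δ x.1)) = _
    generalize Δ x.1 = t
    induction t with
    | zero => simp
    | add => simp_all
    | tmul u v => simp [kernelProj_reduce, rowProj_colProj]
  rw [hcomp, ← comul_hitRight hco]
  by_cases hq₂ : q₂ = h
  · subst hq₂
    rw [hx.2, ← comul_hitLeft hco]
    by_cases hp₁ : p₁ = g
    · subst hp₁
      by_cases hs : p₂ = q₁
      · subst hs
        rw [comul_hitLeft hco, ← hx.2, comul_hitRight hco, ← hcomp]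
        refine Submodule.mem_iSup_of_mem p₂ (mem_range_mapIncl (fun a => ?_) fun b => ?_)
        · rw [evalLeft_map]
          exact C.kernelProj_mem _ _ _
        · rw [evalRight_map]
          exact C.kernelProj_mem _ _ _
      · rw [hx.1, rTensor_hitRight_comul hco, ← LinearMap.comp_apply (LinearMap.lTensor _ _),
          ← LinearMap.lTensor_comp]
        have : C.rowProj q₁ ∘ₗ C.rowProj p₂ = 0 :=
          LinearMap.ext (C.rowProj_rowProj_of_ne (Ne.symm hs))
        rw [this]
        simp
    · rw [← hx.1, C.rowProj_rowProj_of_ne hp₁]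
      simp
  · rw [← hx.2, C.colProj_colProj_of_ne hq₂]
    simp

/-- The reduced colored coalgebra of a pointed coalgebra with splitting: the kernel of the
splitting, colored by the group-like elements. -/
noncomputable def reduced : ReducedColoredCoalg k where
  carrier := C.Kernel
  colors := C.Points
  component := C.kernelComponent
  iSupIndep_component := C.iSupIndep_kernelComponent
  iSup_component := C.iSup_kernelComponent
  comul := C.reducedComul
  coassoc := by
    ext x : 1
    rw [← C.reduce_coe x]
    exact coassoc_apply_map C.reducedComul_reduce Coalgebra.coassoc x.1
  comul_mem := C.reducedComul_mem
  conilpotent x := by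
    obtain ⟨n, hn⟩ := C.pointed.exists_mem_hitFiltration x.1
    refine ⟨n, (ker_iteratedComul _ _ _).2 ?_⟩
    rw [← C.reduce_coe x]
    refine map_mem_hitFiltration C.reducedComul_reduce
      (I := {a | ∀ y ∈ coradical k C.carrier, a y = 0}) (fun a _ y hy => ?_) hn
    -- a functional on `ker δ` gives a functional on `C` that vanishes on the coradical
    rw [LinearMap.comp_apply, ← C.split_apply y hy, reduce_split, map_zero]

/-- For `x ∈ ᵍCʰ`, the comultiplication of the pointed coalgebra is recovered from the reduced one
as `Δ x = g ⊗ x + x ⊗ h + Δ̄ x`. -/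
lemma comul_kernelComponent {g h : C.Points} {x : C.Kernel} (hx : x ∈ C.kernelComponent g h) :
    Δ x.1 = g.1 ⊗ₜ x.1 + x.1 ⊗ₜ h.1 +
      TensorProduct.map C.Kernel.subtype C.Kernel.subtype (C.reducedComul x) := by
  rw [mem_kernelComponent] at hx
  let δ := C.split.toLinearMap
  let π := C.Kernel.subtype ∘ₗ C.reduce
  have hδπ : δ + π = LinearMap.id := by
    ext c
    simp [δ, π, coe_reduce]
  have hl : δ.rTensor _ (Δ x.1) = g.1 ⊗ₜ x.1 := eq_of_evalLeft_eq fun a => by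
    rw [evalLeft_rTensor, ← hitLeft_apply, evalLeft_tmul, ← hx.1,
      C.hitLeft_rowProj (a ∘ₗ δ) fun c => congrArg a (C.split_split c)]
    change a (C.split g.1) • _ = _
    rw [split_point]
  have hr : δ.lTensor _ (Δ x.1) = x.1 ⊗ₜ h.1 := eq_of_evalRight_eq fun a => by
    rw [evalRight_lTensor, ← hitRight_apply, evalRight_tmul, ← hx.2,
      C.hitRight_colProj (a ∘ₗ δ) fun c => congrArg a (C.split_split c)]
    change a (C.split h.1) • _ = _
    rw [split_point]
  have hπx : π x.1 = x.1 := congrArg Subtype.val (C.reduce_coe x)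
  have hδδ : TensorProduct.map δ δ (Δ x.1) = 0 := by
    rw [← C.comul_split, show C.split.toLinearMap x.1 = 0 from x.2, map_zero]
  calc Δ x.1 = TensorProduct.map (δ + π) (δ + π) (Δ x.1) := by rw [hδπ]; simp
    _ = TensorProduct.map δ δ (Δ x.1) + π.lTensor _ (δ.rTensor _ (Δ x.1)) +
        (π.rTensor _ (δ.lTensor _ (Δ x.1)) + TensorProduct.map π π (Δ x.1)) := by
      rw [TensorProduct.map_add_left, TensorProduct.map_add_right, TensorProduct.map_add_right,
        ← LinearMap.comp_apply (LinearMap.lTensor _ _),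
        ← LinearMap.comp_apply (LinearMap.rTensor _ _),
        LinearMap.lTensor_comp_rTensor, LinearMap.rTensor_comp_lTensor]
      rfl
    _ = _ := by
      rw [hl, hr, hδδ, LinearMap.lTensor_tmul, LinearMap.rTensor_tmul, hπx, zero_add, add_assoc,
        TensorProduct.map_comp]
      rfl

end PointedSplitCoalg

/-! ### The equivalence of categories -/

namespace ReducedColoredCoalg

variable {k : Type u} [Field k]

/-- The universal property of `kG ⊕ C`: a coalgebra homomorphism out of it is given by group-like
elements `i g` and a linear map `f` on `C` that satisfies `Δ (f x) = i g ⊗ f x + f x ⊗ i h + …`. -/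
noncomputable def totalHom (X : ReducedColoredCoalg k) {D : Type u} [AddCommGroup D] [Module k D]
    [Coalgebra k D] (i : X.colors → D) (hi : ∀ g, IsGroupLikeElem k (i g))
    (f : X.carrier →ₗ[k] D) (hε : ∀ x, Coalgebra.counit (R := k) (f x) = 0)
    (hΔ : ∀ g h, ∀ x ∈ X.component g h, Coalgebra.comul (R := k) (f x) =
      i g ⊗ₜ f x + f x ⊗ₜ i h + TensorProduct.map f f (X.comul x)) : X.Total →ₗc[k] D where
  __ := X.desc i f
  counit_comp := total_ext (fun g => by simp [(hi g).counit_eq_one]) fun g h x _ => by simp [hε]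
  map_comp_comul := by
    have : X.desc i f ∘ₗ X.inc = f := by ext : 1; simp
    refine total_ext (fun g => by simp [comul_pt, (hi g).comul_eq_tmul_self]) fun g h x hx => ?_
    simp only [LinearMap.comp_apply, X.comul_inc hx, map_add, TensorProduct.map_tmul, desc_inc,
      desc_pt, hΔ g h x hx]
    rw [← LinearMap.comp_apply (TensorProduct.map _ _), ← TensorProduct.map_comp, this]

variable {X Y Z : ReducedColoredCoalg k}

lemma Hom.comul_apply (φ : Hom X Y) (x : X.carrier) :
    Y.comul (φ.toLinearMap x) = TensorProduct.map φ.toLinearMap φ.toLinearMap (X.comul x) :=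
  (LinearMap.congr_fun φ.map_comul x).symm

/-- The coalgebra homomorphism `kG ⊕ C → kS ⊕ D` of a morphism of reduced colored coalgebras. -/
noncomputable def Hom.total (φ : Hom X Y) : X.Total →ₗc[k] Y.Total :=
  X.totalHom (fun g => Y.pt (φ.onColors g)) (fun g => Y.isGroupLikeElem_pt _)
    (Y.inc ∘ₗ φ.toLinearMap) (fun x => by simp) fun g h x hx => by
      rw [LinearMap.comp_apply, Y.comul_inc (φ.map_mem g h x hx), φ.comul_apply,
        TensorProduct.map_comp]
      rfl

@[simp] lemma Hom.total_pt (φ : Hom X Y) (g : X.colors) :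
    φ.total (X.pt g) = Y.pt (φ.onColors g) := X.desc_pt _ _ g

@[simp] lemma Hom.total_inc (φ : Hom X Y) (x : X.carrier) :
    φ.total (X.inc x) = Y.inc (φ.toLinearMap x) := X.desc_inc _ _ x

lemma coalgHom_total_ext {D : Type u} [AddCommGroup D] [Module k D] [Coalgebra k D]
    {φ ψ : X.Total →ₗc[k] D} (h1 : ∀ g, φ (X.pt g) = ψ (X.pt g))
    (h2 : ∀ x, φ (X.inc x) = ψ (X.inc x)) : φ = ψ := by
  have : φ.toLinearMap = ψ.toLinearMap := total_ext h1 fun _ _ x _ => h2 x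
  exact CoalgHom.ext fun y => LinearMap.congr_fun this y

variable (k) in
/-- The functor `(C, G) ↦ kG ⊕ C` from reduced colored coalgebras to pointed coalgebras with a
splitting. -/
noncomputable def totalFunctor : ReducedColoredCoalg k ⥤ PointedSplitCoalg k where
  obj X := X.total
  map {X Y} φ :=
    { toCoalgHom := Hom.total φ
      map_split := fun y => LinearMap.congr_fun
        (f := (Hom.total φ).toLinearMap ∘ₗ X.totalSplit.toLinearMap)
        (g := Y.totalSplit.toLinearMap ∘ₗ (Hom.total φ).toLinearMap)
        (total_ext (fun g => by
          change Hom.total φ (X.totalSplit (X.pt g)) = Y.totalSplit (Hom.total φ (X.pt g))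
          simp) fun g h x _ => by
          change Hom.total φ (X.totalSplit (X.inc x)) = Y.totalSplit (Hom.total φ (X.inc x))
          simp) y }
  map_id X := PointedSplitCoalg.Hom.ext (coalgHom_total_ext (fun g => Hom.total_pt _ g)
    fun x => Hom.total_inc _ x)
  map_comp {X Y Z} φ ψ := PointedSplitCoalg.Hom.ext (coalgHom_total_ext
    (fun g => by
      change Hom.total (φ ≫ ψ) (X.pt g) = Hom.total ψ (Hom.total φ (X.pt g))
      simp only [Hom.total_pt]
      rfl)
    fun x => by
      change Hom.total (φ ≫ ψ) (X.inc x) = Hom.total ψ (Hom.total φ (X.inc x))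
      simp only [Hom.total_inc]
      rfl)

lemma inc_injective (X : ReducedColoredCoalg k) : Function.Injective X.inc := fun _ _ h =>
  congrArg X.out h

instance : (totalFunctor k).Faithful where
  map_injective {X Y φ ψ} h := by
    have h' : Hom.total φ = Hom.total ψ := congrArg PointedSplitCoalg.Hom.toCoalgHom h
    refine Hom.ext (LinearMap.ext fun x => Y.inc_injective ?_) (funext fun g => Y.pt_injective ?_)
    · rw [← Hom.total_inc, h', Hom.total_inc]
    · rw [← Hom.total_pt, h', Hom.total_pt]

/-- The components of `C` are characterized by the coalgebra structure of `kG ⊕ C`, whence they are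
preserved by coalgebra homomorphisms that are compatible with the splittings. -/
lemma mem_component_iff {g h : X.colors} {x : X.carrier} : x ∈ X.component g h ↔
    hitLeft Coalgebra.comul (X.coeff g) (X.inc x) = X.inc x ∧
      hitRight Coalgebra.comul (X.coeff h) (X.inc x) = X.inc x := by
  refine ⟨fun hx => ?_, fun ⟨h1, h2⟩ => ?_⟩
  · rw [X.hitLeft_inc hx _ (by simp), X.hitRight_inc hx _ (by simp)]
    simp
  · have key : ∀ y : X.carrier, hitRight Coalgebra.comul (X.coeff h)
        (hitLeft Coalgebra.comul (X.coeff g) (X.inc y)) ∈ (X.component g h).map X.inc := by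
      intro y
      have hy : y ∈ ⨆ p : X.colors × X.colors, X.component p.1 p.2 := X.iSup_component ▸ trivial
      induction hy using Submodule.iSup_induction' with
      | zero => simp
      | add y z _ _ hy hz =>
        simp only [map_add]
        exact Submodule.add_mem _ hy hz
      | mem p y hy =>
        rw [X.hitLeft_inc hy _ (by simp), map_smul, X.hitRight_inc hy _ (by simp)]
        by_cases h1 : p.1 = g
        · by_cases h2 : p.2 = h
          · subst h1 h2
            rw [coeff_pt_self, coeff_pt_self, one_smul, one_smul]
            exact Submodule.mem_map_of_mem hy
          · simp [X.coeff_pt_of_ne h2]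
        · simp [X.coeff_pt_of_ne h1]
    have := key x
    rw [h1, h2] at this
    obtain ⟨y, hy, hyx⟩ := this
    rwa [← X.inc_injective hyx]

lemma inc_out {y : X.Total} (hy : X.totalSplit y = 0) : X.inc (X.out y) = y := by
  have : X.inc ∘ₗ X.out + X.totalSplit.toLinearMap = LinearMap.id :=
    total_ext (fun g => by
      change X.inc (X.out (X.pt g)) + X.totalSplit (X.pt g) = X.pt g
      simp) fun g h x _ => by
      change X.inc (X.out (X.inc x)) + X.totalSplit (X.inc x) = X.inc x
      simp
  have h := LinearMap.congr_fun this y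
  change X.inc (X.out y) + X.totalSplit y = y at h
  rwa [hy, add_zero] at h

instance : (totalFunctor k).Full where
  map_surjective {X Y} F := by
    let φ : X.Total →ₗc[k] Y.Total := PointedSplitCoalg.Hom.toCoalgHom F
    have hsplit : ∀ y, φ (X.totalSplit y) = Y.totalSplit (φ y) :=
      PointedSplitCoalg.Hom.map_split F
    choose i hi using fun g => Y.exists_eq_pt ((X.isGroupLikeElem_pt g).map φ)
    let f : X.carrier →ₗ[k] Y.carrier := Y.out ∘ₗ φ.toLinearMap ∘ₗ X.inc
    have hf : ∀ x, Y.inc (f x) = φ (X.inc x) := fun x =>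
      inc_out (y := φ (X.inc x)) (by rw [← hsplit, totalSplit_inc, map_zero])
    have hcomul : ∀ y, Coalgebra.comul (R := k) (φ.toLinearMap y) =
        TensorProduct.map φ.toLinearMap φ.toLinearMap (Coalgebra.comul (R := k) y) := fun y =>
      (CoalgHomClass.map_comp_comul_apply φ y).symm
    have hcoeff : ∀ g x, Y.coeff (i g) (φ (X.inc x)) = 0 := fun g x => by
      rw [← hf, coeff_inc]
    have hout : Y.out ∘ₗ φ.toLinearMap = f ∘ₗ X.out := total_ext (fun g => by
      change Y.out (φ (X.pt g)) = f (X.out (X.pt g))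
      rw [hi]
      simp) fun g h x _ => rfl
    let Φ : Hom X Y :=
      { toLinearMap := f
        onColors := i
        map_mem := fun g h x hx => by
          rw [mem_component_iff, hf]
          constructor
          · refine (hitLeft_map (hcomul (X.inc x)) (Y.coeff (i g))).trans ?_
            rw [X.hitLeft_inc hx _ (hcoeff g)]
            change φ (Y.coeff (i g) (φ (X.pt g)) • X.inc x) = _
            rw [hi, coeff_pt_self, one_smul]
          · refine (hitRight_map (hcomul (X.inc x)) (Y.coeff (i h))).trans ?_
            rw [X.hitRight_inc hx _ (hcoeff h)]
            change φ (Y.coeff (i h) (φ (X.pt h)) • X.inc x) = _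
            rw [hi, coeff_pt_self, one_smul]
        map_comul := by
          ext x : 1
          have h1 := Y.comul_out (φ (X.inc x))
          have h2 := X.comul_out (X.inc x)
          rw [out_inc] at h2
          change _ = Y.comul (Y.out (φ (X.inc x)))
          rw [h1]
          refine Eq.trans ?_ (congrArg _ (hcomul (X.inc x))).symm
          rw [LinearMap.comp_apply, h2, ← LinearMap.comp_apply (TensorProduct.map f f),
            ← LinearMap.comp_apply (TensorProduct.map Y.out Y.out), ← TensorProduct.map_comp,
            ← TensorProduct.map_comp, hout] }
    refine ⟨Φ, PointedSplitCoalg.Hom.ext (coalgHom_total_ext (fun g => ?_) fun x => ?_)⟩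
    · exact (Hom.total_pt Φ g).trans (hi g).symm
    · exact (Hom.total_inc Φ x).trans (hf x)

end ReducedColoredCoalg

namespace PointedSplitCoalg

variable {k : Type u} [Field k]

/-- A bijective morphism of pointed coalgebras with splitting is an isomorphism. -/
noncomputable def isoOfBijective {C D : PointedSplitCoalg k} (F : Hom C D)
    (hF : Function.Bijective F.toCoalgHom) : C ≅ D where
  hom := F
  inv :=
    { toCoalgHom := (CoalgEquiv.ofBijective (f := F.toCoalgHom) hF).symm
      map_split := fun y => by
        let e := CoalgEquiv.ofBijective (f := F.toCoalgHom) hF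
        change e.symm (D.split y) = C.split (e.symm y)
        apply e.injective
        refine (e.apply_symm_apply _).trans (Eq.trans ?_ (F.map_split (e.symm y)).symm)
        exact congrArg D.split (e.apply_symm_apply y).symm }
  hom_inv_id := Hom.ext (CoalgHom.ext fun x =>
    (CoalgEquiv.ofBijective (f := F.toCoalgHom) hF).symm_apply_apply x)
  inv_hom_id := Hom.ext (CoalgHom.ext fun x =>
    (CoalgEquiv.ofBijective (f := F.toCoalgHom) hF).apply_symm_apply x)

variable (C : PointedSplitCoalg k)

/-- The inclusion of the group-like elements, as a map out of the colors of `C.reduced`. -/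
def colorIncl : C.reduced.colors → C.carrier := Subtype.val

/-- The inclusion of the kernel of the splitting, as a map out of `C.reduced`. -/
def kernelIncl : C.reduced.carrier →ₗ[k] C.carrier := C.Kernel.subtype

@[simp] lemma split_colorIncl (g : C.reduced.colors) : C.split (C.colorIncl g) = C.colorIncl g :=
  C.split_point g

@[simp] lemma split_kernelIncl (x : C.reduced.carrier) : C.split (C.kernelIncl x) = 0 := x.2

/-- The comparison map `kG ⊕ ker δ → C`, as a coalgebra homomorphism. -/
noncomputable def totalReducedCoalgHom : C.reduced.Total →ₗc[k] C.carrier :=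
  C.reduced.totalHom C.colorIncl Subtype.prop C.kernelIncl
    (fun x => by rw [← counit_split, split_kernelIncl, map_zero])
    fun _ _ _ hx => C.comul_kernelComponent hx

@[simp] lemma totalReducedCoalgHom_pt (g : C.reduced.colors) :
    C.totalReducedCoalgHom (C.reduced.pt g) = C.colorIncl g := C.reduced.desc_pt _ _ g

@[simp] lemma totalReducedCoalgHom_inc (x : C.reduced.carrier) :
    C.totalReducedCoalgHom (C.reduced.inc x) = C.kernelIncl x := C.reduced.desc_inc _ _ x

/-- The comparison map `kG ⊕ ker δ → C`. -/
noncomputable def totalReducedHom : Hom C.reduced.total C where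
  toCoalgHom := C.totalReducedCoalgHom
  map_split := LinearMap.congr_fun
    (f := C.totalReducedCoalgHom.toLinearMap ∘ₗ C.reduced.totalSplit.toLinearMap)
    (g := C.split.toLinearMap ∘ₗ C.totalReducedCoalgHom.toLinearMap)
    (ReducedColoredCoalg.total_ext (fun g => by
      change C.totalReducedCoalgHom (C.reduced.totalSplit (C.reduced.pt g)) =
        C.split (C.totalReducedCoalgHom (C.reduced.pt g))
      simp) fun g h x _ => by
      change C.totalReducedCoalgHom (C.reduced.totalSplit (C.reduced.inc x)) =
        C.split (C.totalReducedCoalgHom (C.reduced.inc x))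
      simp)

lemma totalReducedHom_bijective : Function.Bijective C.totalReducedHom.toCoalgHom := by
  let T : (C.Points →₀ k) × C.Kernel → C.carrier := fun y =>
    Finsupp.linearCombination k Subtype.val y.1 + y.2.1
  change Function.Bijective T
  constructor
  · rintro ⟨v, x⟩ ⟨w, y⟩ hxy
    have hsp : ∀ v x, C.split (T (v, x)) = Finsupp.linearCombination k Subtype.val v := by
      intro v x
      rw [map_add, split_kernel, add_zero]
      refine C.split_apply _ ?_
      rw [Finsupp.linearCombination_apply]
      exact Submodule.sum_mem _ fun g _ => Submodule.smul_mem _ _ g.2.mem_coradical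
    obtain rfl : v = w := C.linearIndependent_points (by rw [← hsp v x, ← hsp w y, hxy])
    obtain rfl : x = y := Subtype.ext (add_left_cancel hxy)
    rfl
  · intro c
    refine ⟨(C.coord c, C.reduce c), ?_⟩
    change Finsupp.linearCombination k Subtype.val (C.coord c) + (C.reduce c).1 = c
    rw [C.linearCombination_coord, coe_reduce, add_sub_cancel]

end PointedSplitCoalg

namespace ReducedColoredCoalg

variable {k : Type u} [Field k]

instance : (totalFunctor k).EssSurj where
  mem_essImage C :=
    ⟨C.reduced, ⟨PointedSplitCoalg.isoOfBijective C.totalReducedHom C.totalReducedHom_bijective⟩⟩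

instance : (totalFunctor k).IsEquivalence where

end ReducedColoredCoalg

/-! ### Colimits of reduced colored coalgebras -/

namespace ReducedColoredCoalg

variable {k : Type u} [Field k]

variable (k) in
/-- The functor that sends a reduced colored coalgebra to its underlying vector space. -/
@[simps]
def forgetToModule : ReducedColoredCoalg k ⥤ ModuleCat.{u} k where
  obj X := ModuleCat.of k X.carrier
  map φ := ModuleCat.ofHom (Hom.toLinearMap φ)

variable (k) in
/-- The functor that sends a reduced colored coalgebra to its set of colors. -/
@[simps]
def forgetToColors : ReducedColoredCoalg k ⥤ Type u where
  obj X := X.colors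
  map φ := TypeCat.ofHom (Hom.onColors φ)

variable {J : Type u} [SmallCategory J] (F : J ⥤ ReducedColoredCoalg k)

/-- The colimit of the underlying vector spaces. -/
noncomputable abbrev ColimitCarrier : Type u := (colimit (F ⋙ forgetToModule k) : ModuleCat.{u} k)

/-- The colimit of the sets of colors. -/
abbrev ColimitColors : Type u := colimit (F ⋙ forgetToColors k)

/-- The coprojections of the colimit of the underlying vector spaces. -/
noncomputable def carrierι (j : J) : (F.obj j).carrier →ₗ[k] ColimitCarrier F :=
  (colimit.ι (F ⋙ forgetToModule k) j).hom

/-- The coprojections of the colimit of the sets of colors. -/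
noncomputable def colorsι (j : J) (g : (F.obj j).colors) : ColimitColors F :=
  colimit.ι (F ⋙ forgetToColors k) j g

variable {F} in
lemma carrierι_map {i j : J} (u : i ⟶ j) (x : (F.obj i).carrier) :
    carrierι F j (Hom.toLinearMap (F.map u) x) = carrierι F i x := by
  have := congrArg ModuleCat.Hom.hom (colimit.w (F ⋙ forgetToModule k) u)
  exact LinearMap.congr_fun this x

variable {F} in
lemma colorsι_map {i j : J} (u : i ⟶ j) (g : (F.obj i).colors) :
    colorsι F j (Hom.onColors (F.map u) g) = colorsι F i g :=
  ConcreteCategory.congr_hom (colimit.w (F ⋙ forgetToColors k) u) g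

variable {F}

lemma colimitCarrier_ext {M : Type u} [AddCommGroup M] [Module k M]
    {φ ψ : ColimitCarrier F →ₗ[k] M} (h : ∀ j x, φ (carrierι F j x) = ψ (carrierι F j x)) :
    φ = ψ := by
  have : ModuleCat.ofHom φ = ModuleCat.ofHom ψ := colimit.hom_ext fun j =>
    ModuleCat.hom_ext (LinearMap.ext (h j))
  exact congrArg ModuleCat.Hom.hom this

lemma exists_colimitCarrier_lift {M : Type u} [AddCommGroup M] [Module k M]
    (f : ∀ j, (F.obj j).carrier →ₗ[k] M)
    (hf : ∀ {i j : J} (u : i ⟶ j) x, f j (Hom.toLinearMap (F.map u) x) = f i x) :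
    ∃ φ : ColimitCarrier F →ₗ[k] M, ∀ j x, φ (carrierι F j x) = f j x := by
  let c : Cocone (F ⋙ forgetToModule k) :=
    { pt := ModuleCat.of k M
      ι :=
        { app := fun j => ModuleCat.ofHom (f j)
          naturality := fun i j u => ModuleCat.hom_ext (LinearMap.ext (hf u)) } }
  refine ⟨(colimit.desc _ c).hom, fun j x => ?_⟩
  exact LinearMap.congr_fun (congrArg ModuleCat.Hom.hom (colimit.ι_desc c j)) x

lemma exists_colimitColors_lift {S : Type u} (f : ∀ j, (F.obj j).colors → S)
    (hf : ∀ {i j : J} (u : i ⟶ j) g, f j (Hom.onColors (F.map u) g) = f i g) :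
    ∃ φ : ColimitColors F → S, ∀ j g, φ (colorsι F j g) = f j g := by
  let c : Cocone (F ⋙ forgetToColors k) :=
    { pt := S
      ι :=
        { app := fun j => TypeCat.ofHom (f j)
          naturality := fun i j u => by
            ext g
            exact hf u g } }
  refine ⟨fun x => colimit.desc _ c x, fun j g => ?_⟩
  exact ConcreteCategory.congr_hom (colimit.ι_desc c j) g

lemma exists_colorsι (g : ColimitColors F) : ∃ j h, colorsι F j h = g :=
  Types.jointly_surjective' g

lemma iSup_range_carrierι : ⨆ j, LinearMap.range (carrierι F j) = ⊤ := by
  rw [← Submodule.ker_mkQ (⨆ j, LinearMap.range (carrierι F j)), LinearMap.ker_eq_top]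
  refine colimitCarrier_ext fun j x => ?_
  rw [LinearMap.zero_apply, Submodule.mkQ_apply, Submodule.Quotient.mk_eq_zero]
  exact Submodule.mem_iSup_of_mem j ⟨x, rfl⟩

variable (F)

/-- The component `ᵍCʰ` of a colimit: the span of the images of all components whose colors are
sent to `g` and `h`. -/
noncomputable def colimitComponent (g h : ColimitColors F) : Submodule k (ColimitCarrier F) :=
  ⨆ (j : J) (p : (F.obj j).colors × (F.obj j).colors)
    (_ : colorsι F j p.1 = g ∧ colorsι F j p.2 = h),
    ((F.obj j).component p.1 p.2).map (carrierι F j)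

variable {F} in
lemma carrierι_mem {j : J} {g h : (F.obj j).colors} {x : (F.obj j).carrier}
    (hx : x ∈ (F.obj j).component g h) :
    carrierι F j x ∈ colimitComponent F (colorsι F j g) (colorsι F j h) :=
  Submodule.mem_iSup_of_mem j (Submodule.mem_iSup_of_mem (g, h)
    (Submodule.mem_iSup_of_mem ⟨rfl, rfl⟩ (Submodule.mem_map_of_mem hx)))

lemma iSup_colimitComponent :
    ⨆ p : ColimitColors F × ColimitColors F, colimitComponent F p.1 p.2 = ⊤ := by
  rw [eq_top_iff, ← iSup_range_carrierι]
  refine iSup_le fun j => ?_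
  rintro _ ⟨x, rfl⟩
  have : (⊤ : Submodule k (F.obj j).carrier) ≤
      (⨆ p : ColimitColors F × ColimitColors F, colimitComponent F p.1 p.2).comap
        (carrierι F j) := by
    rw [← (F.obj j).iSup_component]
    exact iSup_le fun p x hx => Submodule.mem_iSup_of_mem (_, _) (carrierι_mem hx)
  exact this trivial

open Classical in
lemma iSupIndep_colimitComponent :
    iSupIndep fun p : ColimitColors F × ColimitColors F => colimitComponent F p.1 p.2 := by
  -- the homogeneous projections of the terms of the diagram onto all components whose colors are
  -- sent to `p` induce a projection of the colimit
  have hP : ∀ p : ColimitColors F × ColimitColors F,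
      ∃ φ : ColimitCarrier F →ₗ[k] ColimitCarrier F, ∀ j x, φ (carrierι F j x) =
        (F.obj j).lift (fun g h => if (colorsι F j g, colorsι F j h) = p then carrierι F j else 0)
          x := by
    intro p
    refine exists_colimitCarrier_lift _ fun {i j} u x => ?_
    let φ (j : J) : (F.obj j).carrier →ₗ[k] ColimitCarrier F := (F.obj j).lift fun g h =>
      if (colorsι F j g, colorsι F j h) = p then carrierι F j else 0
    suffices φ j ∘ₗ Hom.toLinearMap (F.map u) = φ i from LinearMap.congr_fun this x
    refine hom_ext_component fun g h x hx => ?_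
    rw [LinearMap.comp_apply, lift_apply _ _ hx, lift_apply _ _ (Hom.map_mem (F.map u) g h x hx),
      colorsι_map, colorsι_map]
    split_ifs
    · exact carrierι_map u x
    · rfl
  choose P hP using hP
  have key : ∀ p q : ColimitColors F × ColimitColors F, ∀ x ∈ colimitComponent F p.1 p.2,
      P q x = if p = q then x else 0 := by
    intro p q
    let f : ColimitCarrier F →ₗ[k] ColimitCarrier F := if p = q then LinearMap.id else 0
    have hf : ∀ x, f x = if p = q then x else 0 := fun x => by
      dsimp only [f]
      split_ifs <;> rfl
    have : colimitComponent F p.1 p.2 ≤ LinearMap.eqLocus (P q) f := by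
      refine iSup_le fun j => iSup_le fun r => iSup_le fun ⟨hr1, hr2⟩ => ?_
      rintro _ ⟨x, hx, rfl⟩
      change P q _ = f _
      rw [hP, hf, lift_apply _ _ hx, hr1, hr2]
      split_ifs <;> rfl
    intro x hx
    rw [← hf]
    exact this hx
  exact iSupIndep_of_projection P (fun p x hx => by rw [key p p x hx, if_pos rfl])
    fun p q hpq x hx => by rw [key p q x hx, if_neg hpq]

lemma exists_colimitComul : ∃ Δ : ColimitCarrier F →ₗ[k] ColimitCarrier F ⊗[k] ColimitCarrier F,
    ∀ j x, Δ (carrierι F j x) =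
      TensorProduct.map (carrierι F j) (carrierι F j) ((F.obj j).comul x) := by
  refine exists_colimitCarrier_lift
    (fun j => TensorProduct.map (carrierι F j) (carrierι F j) ∘ₗ (F.obj j).comul)
    fun {i j} u x => ?_
  have h : carrierι F j ∘ₗ Hom.toLinearMap (F.map u) = carrierι F i :=
    LinearMap.ext (carrierι_map u)
  rw [LinearMap.comp_apply, Hom.comul_apply (F.map u),
    ← LinearMap.comp_apply (TensorProduct.map _ _), ← TensorProduct.map_comp, h]
  rfl

/-- The comultiplication of a colimit. -/
noncomputable def colimitComul :
    ColimitCarrier F →ₗ[k] ColimitCarrier F ⊗[k] ColimitCarrier F :=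
  (exists_colimitComul F).choose

variable {F} in
lemma colimitComul_carrierι (j : J) (x : (F.obj j).carrier) :
    colimitComul F (carrierι F j x) =
      TensorProduct.map (carrierι F j) (carrierι F j) ((F.obj j).comul x) :=
  (exists_colimitComul F).choose_spec j x

/-- The colimit of a diagram of reduced colored coalgebras, computed in vector spaces and sets. -/
noncomputable def colimitObj : ReducedColoredCoalg k where
  carrier := ColimitCarrier F
  colors := ColimitColors F
  component := colimitComponent F
  iSupIndep_component := iSupIndep_colimitComponent F
  iSup_component := iSup_colimitComponent F
  comul := colimitComul F
  coassoc := colimitCarrier_ext fun j x =>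
    coassoc_apply_map (colimitComul_carrierι j) (F.obj j).coassoc x
  comul_mem g h := by
    have : colimitComponent F g h ≤ (⨆ s, LinearMap.range (TensorProduct.mapIncl
        (colimitComponent F g s) (colimitComponent F s h))).comap (colimitComul F) := by
      refine iSup_le fun j => iSup_le fun p => iSup_le fun ⟨h1, h2⟩ => ?_
      rintro _ ⟨x, hx, rfl⟩
      rw [Submodule.mem_comap, colimitComul_carrierι]
      have hle : (⨆ s, LinearMap.range (TensorProduct.mapIncl ((F.obj j).component p.1 s)
          ((F.obj j).component s p.2))) ≤ (⨆ s, LinearMap.range (TensorProduct.mapIncl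
          (colimitComponent F g s) (colimitComponent F s h))).comap
            (TensorProduct.map (carrierι F j) (carrierι F j)) := by
        refine iSup_le fun s y hy => ?_
        refine Submodule.mem_iSup_of_mem (colorsι F j s)
          (mem_range_mapIncl (fun a => ?_) fun b => ?_)
        · rw [evalLeft_map, ← h2]
          exact carrierι_mem (evalLeft_mem_of_mem_range hy _)
        · rw [evalRight_map, ← h1]
          exact carrierι_mem (evalRight_mem_of_mem_range hy _)
      exact hle ((F.obj j).comul_mem _ _ x hx)
    exact this
  conilpotent x := by
    have hx : x ∈ ⨆ j, LinearMap.range (carrierι F j) := iSup_range_carrierι (F := F) ▸ trivial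
    suffices ∃ n, x ∈ hitFiltration (colimitComul F) Set.univ n from
      this.imp fun n => (ker_iteratedComul _ n x).2
    induction hx using Submodule.iSup_induction' with
    | zero => exact ⟨0, Submodule.zero_mem _⟩
    | add x y _ _ hx hy =>
      obtain ⟨m, hm⟩ := hx
      obtain ⟨n, hn⟩ := hy
      exact ⟨max m n, Submodule.add_mem _ (hitFiltration_mono _ (le_max_left m n) hm)
        (hitFiltration_mono _ (le_max_right m n) hn)⟩
    | mem j x hx =>
      obtain ⟨x, rfl⟩ := hx
      obtain ⟨n, hn⟩ := (F.obj j).conilpotent x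
      exact ⟨n, map_mem_hitFiltration (I := Set.univ) (colimitComul_carrierι j)
        (fun _ _ => trivial)
        ((ker_iteratedComul _ n x).1 hn)⟩

/-- The colimit cocone of a diagram of reduced colored coalgebras. -/
noncomputable def colimitCocone : Cocone F where
  pt := colimitObj F
  ι :=
    { app := fun j =>
        { toLinearMap := carrierι F j
          onColors := colorsι F j
          map_mem := fun _ _ _ hx => carrierι_mem hx
          map_comul := LinearMap.ext fun x => (colimitComul_carrierι j x).symm }
      naturality := fun _ _ u => Hom.ext (LinearMap.ext (carrierι_map u))
        (funext (colorsι_map u)) }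

lemma exists_colimit_desc (s : Cocone F) : ∃ φ : colimitObj F ⟶ s.pt,
    ∀ j, (colimitCocone F).ι.app j ≫ φ = s.ι.app j := by
  obtain ⟨f, hf⟩ := exists_colimitCarrier_lift (F := F)
    (fun j => Hom.toLinearMap (s.ι.app j)) fun u x =>
      LinearMap.congr_fun (congrArg Hom.toLinearMap (s.w u)) x
  obtain ⟨i, hi⟩ := exists_colimitColors_lift (F := F)
    (fun j => Hom.onColors (s.ι.app j)) fun u x => congrFun (congrArg Hom.onColors (s.w u)) x
  have hf' : ∀ j, f ∘ₗ carrierι F j = Hom.toLinearMap (s.ι.app j) := fun j => LinearMap.ext (hf j)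
  refine ⟨{ toLinearMap := f
            onColors := i
            map_mem := fun g h => ?_
            map_comul := ?_ }, fun j => Hom.ext (hf' j) (funext (hi j))⟩
  · have : colimitComponent F g h ≤ (s.pt.component (i g) (i h)).comap f := by
      refine iSup_le fun j => iSup_le fun p => iSup_le fun ⟨h1, h2⟩ => ?_
      rintro _ ⟨x, hx, rfl⟩
      rw [Submodule.mem_comap, hf, ← h1, ← h2, hi, hi]
      exact Hom.map_mem (s.ι.app j) _ _ x hx
    exact this
  · refine colimitCarrier_ext fun j x => ?_
    change TensorProduct.map f f (colimitComul F (carrierι F j x)) = s.pt.comul (f (carrierι F j x))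
    rw [colimitComul_carrierι, hf, Hom.comul_apply, ← hf', TensorProduct.map_comp]
    rfl

/-- The colimit cocone is universal. -/
noncomputable def isColimitColimitCocone : IsColimit (colimitCocone F) where
  desc s := (exists_colimit_desc F s).choose
  fac s := (exists_colimit_desc F s).choose_spec
  uniq s φ hφ := by
    have h := fun j => (hφ j).trans ((exists_colimit_desc F s).choose_spec j).symm
    refine Hom.ext (colimitCarrier_ext fun j x => ?_) (funext fun g => ?_)
    · exact LinearMap.congr_fun (congrArg Hom.toLinearMap (h j)) x
    · obtain ⟨j, g, rfl⟩ := exists_colorsι g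
      exact congrFun (congrArg Hom.onColors (h j)) g

instance : HasColimits (ReducedColoredCoalg k) where
  has_colimits_of_shape _ _ :=
    { has_colimit := fun F => ⟨⟨colimitCocone F, isColimitColimitCocone F⟩⟩ }

end ReducedColoredCoalg

/-! ### Restriction along injections -/

namespace ReducedColoredCoalg

variable {k : Type u} [Field k]

/-- The projection of a reduced colored coalgebra onto its component `ᵍCʰ`. -/
noncomputable def proj (X : ReducedColoredCoalg k) (p : X.colors × X.colors) :
    X.carrier →ₗ[k] X.carrier :=
  gradedProj X.iSupIndep_component X.iSup_component p

lemma proj_of_mem (X : ReducedColoredCoalg k) {g h : X.colors} {x : X.carrier}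
    (hx : x ∈ X.component g h) : X.proj (g, h) x = x :=
  gradedProj_of_mem X.iSupIndep_component X.iSup_component (i := (g, h)) hx

lemma proj_of_mem_of_ne (X : ReducedColoredCoalg k) {g h : X.colors} {p : X.colors × X.colors}
    (hp : (g, h) ≠ p) {x : X.carrier} (hx : x ∈ X.component g h) : X.proj p x = 0 :=
  gradedProj_of_mem_of_ne X.iSupIndep_component X.iSup_component hp hx

lemma proj_mem (X : ReducedColoredCoalg k) (p : X.colors × X.colors) (x : X.carrier) :
    X.proj p x ∈ X.component p.1 p.2 :=
  gradedProj_mem X.iSupIndep_component X.iSup_component p x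

lemma map_proj_comul (X : ReducedColoredCoalg k) {g h : X.colors} {x : X.carrier}
    (hx : x ∈ X.component g h) (p q : X.colors × X.colors)
    (hpq : ¬ (p.1 = g ∧ p.2 = q.1 ∧ q.2 = h)) :
    TensorProduct.map (X.proj p) (X.proj q) (X.comul x) = 0 := by
  refine X.eq_on_comul (φ := TensorProduct.map (X.proj p) (X.proj q)) (ψ := 0)
    (fun s u hu v hv => ?_) hx
  rw [TensorProduct.map_tmul, LinearMap.zero_apply]
  by_cases h1 : (g, s) = p
  · by_cases h2 : (s, h) = q
    · subst h1 h2
      exact absurd ⟨rfl, rfl, rfl⟩ hpq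
    · rw [X.proj_of_mem_of_ne h2 hv, TensorProduct.tmul_zero]
  · rw [X.proj_of_mem_of_ne h1 hu, TensorProduct.zero_tmul]

section Restrict

variable (X : ReducedColoredCoalg k) {V S : Type u} [AddCommGroup V] [Module k V]
  (e : V →ₗ[k] X.carrier) (c : S → X.colors)

/-- The components of the restriction of a reduced colored coalgebra. -/
def restrictComponent (s t : S) : Submodule k V := (X.component (c s) (c t)).comap e

variable {X e c} (he : Function.Injective e) (hc : Function.Injective c)
  (hcomul : ∀ v, X.comul (e v) ∈ LinearMap.range (TensorProduct.map e e))
  (hsup : ⨆ p : S × S, X.restrictComponent e c p.1 p.2 = ⊤)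

include he hc in
lemma iSupIndep_restrictComponent :
    iSupIndep fun p : S × S => X.restrictComponent e c p.1 p.2 := by
  obtain ⟨r, hr⟩ := e.exists_leftInverse_of_injective (LinearMap.ker_eq_bot.2 he)
  refine iSupIndep_of_projection (fun p => r ∘ₗ X.proj (c p.1, c p.2) ∘ₗ e)
    (fun p v hv => ?_) fun p q hpq v hv => ?_
  · rw [LinearMap.comp_apply, LinearMap.comp_apply, X.proj_of_mem hv]
    exact LinearMap.congr_fun hr v
  · rw [LinearMap.comp_apply, LinearMap.comp_apply, X.proj_of_mem_of_ne _ hv, map_zero]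
    exact fun h => hpq (Prod.ext (hc (congrArg Prod.fst h)) (hc (congrArg Prod.snd h)))

include he hcomul in
lemma exists_restrictComul : ∃ Δ : V →ₗ[k] V ⊗[k] V,
    ∀ v, X.comul (e v) = TensorProduct.map e e (Δ v) := by
  obtain ⟨r, hr⟩ := e.exists_leftInverse_of_injective (LinearMap.ker_eq_bot.2 he)
  refine ⟨TensorProduct.map r r ∘ₗ X.comul ∘ₗ e, fun v => ?_⟩
  obtain ⟨t, ht⟩ := hcomul v
  rw [LinearMap.comp_apply, LinearMap.comp_apply, ← ht, ← LinearMap.comp_apply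
    (TensorProduct.map r r), ← TensorProduct.map_comp, hr, TensorProduct.map_id]
  rfl

/-- The restriction of a reduced colored coalgebra along an injective linear map onto a
bihomogeneous subcoalgebra and an injection of colors. -/
noncomputable def restrict : ReducedColoredCoalg k where
  carrier := V
  colors := S
  component := X.restrictComponent e c
  iSupIndep_component := iSupIndep_restrictComponent he hc
  iSup_component := hsup
  comul := (exists_restrictComul he hcomul).choose
  coassoc := by
    have hΔ := (exists_restrictComul he hcomul).choose_spec
    ext v : 1
    apply TensorProduct.map_injective_of_flat_flat _ _ he
      (TensorProduct.map_injective_of_flat_flat _ _ he he)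
    refine (assoc_rTensor_comul_map hΔ v).symm.trans
      (Eq.trans ?_ (lTensor_comul_map hΔ v))
    exact LinearMap.congr_fun X.coassoc (e v)
  comul_mem s t v hv := by
    have hΔ := (exists_restrictComul he hcomul).choose_spec
    have hind := iSupIndep_restrictComponent he hc
    have hproj : ∀ (p : S × S) (v : V),
        e (gradedProj hind hsup p v) = X.proj (c p.1, c p.2) (e v) := by
      intro p v
      refine LinearMap.congr_fun (f := e ∘ₗ gradedProj hind hsup p)
        (g := X.proj (c p.1, c p.2) ∘ₗ e) (LinearMap.ext_of_iSup_eq_top hsup fun q v hv => ?_) v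
      rw [LinearMap.comp_apply, LinearMap.comp_apply]
      by_cases hqp : q = p
      · subst hqp
        rw [gradedProj_of_mem hind hsup hv, X.proj_of_mem hv]
      · rw [gradedProj_of_mem_of_ne hind hsup hqp hv, X.proj_of_mem_of_ne _ hv, map_zero]
        exact fun h => hqp (Prod.ext (hc (congrArg Prod.fst h)) (hc (congrArg Prod.snd h)))
    have hproj' : ∀ p : S × S, e ∘ₗ gradedProj hind hsup p = X.proj (c p.1, c p.2) ∘ₗ e :=
      fun p => LinearMap.ext (hproj p)
    refine mem_of_gradedProj_mem hind hsup fun p q => ?_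
    by_cases hpq : c p.1 = c s ∧ c p.2 = c q.1 ∧ c q.2 = c t
    · obtain ⟨p₁, p₂⟩ := p
      obtain ⟨q₁, q₂⟩ := q
      obtain ⟨h1, h2, h3⟩ := hpq
      obtain rfl := hc h1
      obtain rfl := hc h2
      obtain rfl := hc h3
      refine Submodule.mem_iSup_of_mem p₂ (mem_range_mapIncl (fun a => ?_) fun b => ?_)
      · rw [evalLeft_map]
        exact gradedProj_mem hind hsup (p₂, q₂) _
      · rw [evalRight_map]
        exact gradedProj_mem hind hsup (p₁, p₂) _
    · have h0 := X.map_proj_comul hv (c p.1, c p.2) (c q.1, c q.2) hpq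
      rw [hΔ, ← LinearMap.comp_apply, ← TensorProduct.map_comp,
        ← hproj' p, ← hproj' q, TensorProduct.map_comp, LinearMap.comp_apply] at h0
      rw [TensorProduct.map_injective_of_flat_flat _ _ he he (h0.trans (map_zero _).symm)]
      exact Submodule.zero_mem _
  conilpotent v := by
    have hΔ := (exists_restrictComul he hcomul).choose_spec
    obtain ⟨r, hr⟩ := e.exists_leftInverse_of_injective (LinearMap.ker_eq_bot.2 he)
    have key : ∀ n v, e v ∈ hitFiltration X.comul Set.univ n →
        v ∈ hitFiltration (exists_restrictComul he hcomul).choose Set.univ n := by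
      intro n
      induction n with
      | zero => exact fun v hv => he (hv.trans (map_zero e).symm)
      | succ n ih =>
        intro v hv
        refine mem_hitFiltration_succ.2 fun a _ => ih _ ?_
        have h1 := mem_hitFiltration_succ.1 hv (a ∘ₗ r) trivial
        rwa [hitLeft_map (hΔ v), LinearMap.comp_assoc, hr, LinearMap.comp_id] at h1
    obtain ⟨n, hn⟩ := X.conilpotent (e v)
    exact ⟨n, (ker_iteratedComul _ _ _).2 (key n v ((ker_iteratedComul _ _ _).1 hn))⟩

/-- The inclusion of a restriction. -/
noncomputable def restrictHom : restrict he hc hcomul hsup ⟶ X where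
  toLinearMap := e
  onColors := c
  map_mem _ _ _ hv := hv
  map_comul := LinearMap.ext fun v => ((exists_restrictComul he hcomul).choose_spec v).symm

end Restrict

variable {X Y Z : ReducedColoredCoalg k}

lemma Hom.apply_proj (φ : Hom X Y) (hφ : Function.Injective φ.onColors) (g h : X.colors)
    (x : X.carrier) : φ.toLinearMap (X.proj (g, h) x) =
      Y.proj (φ.onColors g, φ.onColors h) (φ.toLinearMap x) := by
  refine LinearMap.congr_fun (f := φ.toLinearMap ∘ₗ X.proj (g, h))
    (g := Y.proj (φ.onColors g, φ.onColors h) ∘ₗ φ.toLinearMap)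
    (hom_ext_component fun s t x hx => ?_) x
  rw [LinearMap.comp_apply, LinearMap.comp_apply]
  by_cases hst : (s, t) = (g, h)
  · rw [← hst, X.proj_of_mem hx]
    obtain ⟨rfl, rfl⟩ := Prod.mk.inj hst
    rw [Y.proj_of_mem (φ.map_mem _ _ _ hx)]
  · rw [X.proj_of_mem_of_ne hst hx, Y.proj_of_mem_of_ne _ (φ.map_mem _ _ _ hx), map_zero]
    exact fun h => hst (Prod.ext (hφ (congrArg Prod.fst h)) (hφ (congrArg Prod.snd h)))

/-- An injective morphism reflects the components. -/
lemma Hom.mem_component_of_injective (φ : Hom X Y) (hφ : Function.Injective φ.toLinearMap)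
    (hφ' : Function.Injective φ.onColors) {g h : X.colors} {x : X.carrier}
    (hx : φ.toLinearMap x ∈ Y.component (φ.onColors g) (φ.onColors h)) :
    x ∈ X.component g h := by
  have : X.proj (g, h) x = x := hφ (by rw [φ.apply_proj hφ', Y.proj_of_mem hx])
  rw [← this]
  exact X.proj_mem (g, h) x

/-- A morphism whose image is contained in the image of an injective morphism factors through
it. -/
lemma Hom.exists_factorization (j : Y ⟶ X) (hj : Function.Injective (Hom.toLinearMap j))
    (hj' : Function.Injective (Hom.onColors j)) (u : Z ⟶ X)
    (h : LinearMap.range (Hom.toLinearMap u) ≤ LinearMap.range (Hom.toLinearMap j))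
    (h' : Set.range (Hom.onColors u) ⊆ Set.range (Hom.onColors j)) :
    ∃ v : Z ⟶ Y, v ≫ j = u := by
  obtain ⟨r, hr⟩ := (Hom.toLinearMap j).exists_leftInverse_of_injective (LinearMap.ker_eq_bot.2 hj)
  have hv : ∀ z, Hom.toLinearMap j (r (Hom.toLinearMap u z)) = Hom.toLinearMap u z := by
    intro z
    obtain ⟨y, hy⟩ := h ⟨z, rfl⟩
    rw [← hy]
    exact congrArg _ (LinearMap.congr_fun hr y)
  choose i hi using fun g => h' ⟨g, rfl⟩
  have hjv : Hom.toLinearMap j ∘ₗ r ∘ₗ Hom.toLinearMap u = Hom.toLinearMap u := LinearMap.ext hv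
  refine ⟨{ toLinearMap := r ∘ₗ Hom.toLinearMap u
            onColors := i
            map_mem := fun g h z hz => ?_
            map_comul := ?_ }, Hom.ext hjv (funext hi)⟩
  · refine Hom.mem_component_of_injective j hj hj' ?_
    rw [LinearMap.comp_apply, hv, hi, hi]
    exact Hom.map_mem u g h z hz
  · ext z : 1
    apply TensorProduct.map_injective_of_flat_flat _ _ hj hj
    rw [LinearMap.comp_apply, ← LinearMap.comp_apply (TensorProduct.map _ _),
      ← TensorProduct.map_comp, hjv, LinearMap.comp_apply, ← Hom.comul_apply j,
      LinearMap.comp_apply, hv, Hom.comul_apply u]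

/-! ### Finite subobjects -/

/-- In the pointed coalgebra `kG ⊕ C`, the projection onto `ᵍCʰ` is given by dual actions. -/
lemma proj_out (X : ReducedColoredCoalg k) (g h : X.colors) (y : X.Total) :
    X.proj (g, h) (X.out y) = X.out (hitRight Coalgebra.comul (X.coeff h)
      (hitLeft Coalgebra.comul (X.coeff g) y)) := by
  refine LinearMap.congr_fun (f := X.proj (g, h) ∘ₗ X.out) (g := X.out ∘ₗ
    hitRight Coalgebra.comul (X.coeff h) ∘ₗ hitLeft Coalgebra.comul (X.coeff g))
    (total_ext (fun s => ?_) fun s t x hx => ?_) y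
  · simp only [LinearMap.comp_apply, (X.isGroupLikeElem_pt s).hitLeft, map_smul,
      (X.isGroupLikeElem_pt s).hitRight, out_pt, map_zero, smul_zero]
  · simp only [LinearMap.comp_apply, X.hitLeft_inc hx _ (X.coeff_inc g), map_smul,
      X.hitRight_inc hx _ (X.coeff_inc h), out_inc]
    by_cases h1 : s = g
    · by_cases h2 : t = h
      · subst h1 h2
        rw [X.proj_of_mem hx, coeff_pt_self, coeff_pt_self, one_smul, one_smul]
      · rw [X.proj_of_mem_of_ne (fun h => h2 (congrArg Prod.snd h)) hx, X.coeff_pt_of_ne h2,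
          zero_smul, smul_zero]
    · rw [X.proj_of_mem_of_ne (fun h => h1 (congrArg Prod.fst h)) hx, X.coeff_pt_of_ne h1,
        zero_smul]

/-- The fundamental theorem of coalgebras, for reduced colored coalgebras: finite-dimensional
subspaces are contained in finite-dimensional bihomogeneous subcoalgebras. -/
lemma exists_finiteDimensional_subcoalgebra (X : ReducedColoredCoalg k)
    (W : Submodule k X.carrier) [FiniteDimensional k W] :
    ∃ D : Submodule k X.carrier, FiniteDimensional k D ∧ W ≤ D ∧
      (∀ x ∈ D, X.comul x ∈ LinearMap.range (TensorProduct.mapIncl D D)) ∧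
      ∀ p, ∀ x ∈ D, X.proj p x ∈ D := by
  obtain ⟨E, _, hWE, hL, hR⟩ := exists_finiteDimensional_stable
    (Coalgebra.coassoc (R := k) (A := X.Total)) (W.map X.inc)
  refine ⟨E.map X.out, inferInstance, fun x hx => ⟨X.inc x, ?_, rfl⟩, ?_, ?_⟩
  · simpa using hWE _ (Submodule.mem_map_of_mem hx) Coalgebra.counit Coalgebra.counit
  · rintro _ ⟨y, hy, rfl⟩
    refine mem_range_mapIncl (fun a => ?_) fun b => ?_
    · rw [← hitLeft_apply, hitLeft_map (X.comul_out y)]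
      exact Submodule.mem_map_of_mem (hL y hy _)
    · rw [← hitRight_apply, hitRight_map (X.comul_out y)]
      exact Submodule.mem_map_of_mem (hR y hy _)
  · rintro ⟨g, h⟩ _ ⟨y, hy, rfl⟩
    rw [proj_out]
    exact Submodule.mem_map_of_mem (hR _ (hL y hy _) _)

variable (k) in
/-- A reduced colored coalgebra with underlying vector space `kⁿ` and `m` colors. These form a
small set of representatives of the reduced colored coalgebras that are finite-dimensional and
have finitely many colors. -/
structure FiniteModel where
  /-- the dimension -/
  dim : ℕ
  /-- the number of colors -/
  numColors : ℕ
  /-- the homogeneous components -/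
  component : ULift.{u} (Fin numColors) → ULift.{u} (Fin numColors) → Submodule k (Fin dim → k)
  iSupIndep_component : iSupIndep
    fun p : ULift.{u} (Fin numColors) × ULift.{u} (Fin numColors) => component p.1 p.2
  iSup_component : ⨆ p : ULift.{u} (Fin numColors) × ULift.{u} (Fin numColors),
    component p.1 p.2 = ⊤
  /-- the comultiplication -/
  comul : (Fin dim → k) →ₗ[k] (Fin dim → k) ⊗[k] (Fin dim → k)
  coassoc : TensorProduct.assoc k (Fin dim → k) (Fin dim → k) (Fin dim → k) ∘ₗ
    comul.rTensor (Fin dim → k) ∘ₗ comul = comul.lTensor (Fin dim → k) ∘ₗ comul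
  comul_mem : ∀ g h, ∀ x ∈ component g h,
    comul x ∈ ⨆ s, LinearMap.range (TensorProduct.mapIncl (component g s) (component s h))
  conilpotent : ∀ x : Fin dim → k, ∃ n : ℕ, iteratedComul k comul n x = 0

/-- The reduced colored coalgebra of a finite model. -/
def FiniteModel.obj (A : FiniteModel k) : ReducedColoredCoalg k where
  carrier := Fin A.dim → k
  colors := ULift.{u} (Fin A.numColors)
  component := A.component
  iSupIndep_component := A.iSupIndep_component
  iSup_component := A.iSup_component
  comul := A.comul
  coassoc := A.coassoc
  comul_mem := A.comul_mem
  conilpotent := A.conilpotent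

instance (A : FiniteModel k) : FiniteDimensional k A.obj.carrier :=
  inferInstanceAs (FiniteDimensional k (Fin A.dim → k))

instance (A : FiniteModel k) : Finite A.obj.colors :=
  inferInstanceAs (Finite (ULift.{u} (Fin A.numColors)))

/-- Finitely many elements and colors of a reduced colored coalgebra lie in the image of an
injective morphism from a finite model. -/
lemma exists_finiteModel (X : ReducedColoredCoalg k) (W : Submodule k X.carrier)
    [FiniteDimensional k W] (T : Set X.colors) (hT : T.Finite) :
    ∃ (A : FiniteModel k) (j : A.obj ⟶ X), Function.Injective (Hom.toLinearMap j) ∧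
      Function.Injective (Hom.onColors j) ∧ W ≤ LinearMap.range (Hom.toLinearMap j) ∧
      T ⊆ Set.range (Hom.onColors j) := by
  classical
  obtain ⟨D, _, hWD, hD, hDp⟩ := X.exists_finiteDimensional_subcoalgebra W
  obtain ⟨B, hB⟩ : D.FG := Module.Finite.iff_fg.1 ‹_›
  choose F hF using fun x => exists_sum_gradedProj X.iSupIndep_component X.iSup_component x
  -- the colors of `T` together with the colors of all components of a finite spanning set of `D`
  let S : Finset X.colors := hT.toFinset ∪ B.biUnion fun x =>
    (F x).image Prod.fst ∪ (F x).image Prod.snd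
  have hTS : T ⊆ S := fun g hg => by simp [S, hg]
  have hFS : ∀ x ∈ B, ∀ p ∈ F x, p.1 ∈ S ∧ p.2 ∈ S := fun x hx p hp =>
    ⟨Finset.mem_union_right _ (Finset.mem_biUnion.2
      ⟨x, hx, Finset.mem_union_left _ (Finset.mem_image_of_mem _ hp)⟩),
      Finset.mem_union_right _ (Finset.mem_biUnion.2
      ⟨x, hx, Finset.mem_union_right _ (Finset.mem_image_of_mem _ hp)⟩)⟩
  let ε : (Fin (Module.finrank k D) → k) ≃ₗ[k] D := (Module.finBasis k D).equivFun.symm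
  let e : (Fin (Module.finrank k D) → k) →ₗ[k] X.carrier := D.subtype ∘ₗ ε.toLinearMap
  let c : ULift.{u} (Fin S.card) → X.colors := fun i => (S.equivFin.symm i.down).1
  have hrange : LinearMap.range e = D := by
    rw [LinearMap.range_comp_of_range_eq_top _ (LinearEquiv.range ε), Submodule.range_subtype]
  have he : Function.Injective e := D.injective_subtype.comp ε.injective
  have hc : Function.Injective c := Subtype.val_injective.comp
    (S.equivFin.symm.injective.comp ULift.down_injective)
  have hcS : ∀ g ∈ S, ∃ i, c i = g := fun g hg => ⟨⟨S.equivFin ⟨g, hg⟩⟩, by simp [c]⟩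
  have hcomul : ∀ v, X.comul (e v) ∈ LinearMap.range (TensorProduct.map e e) := by
    intro v
    obtain ⟨t, ht⟩ := hD (e v) (ε v).2
    refine ⟨TensorProduct.map ε.symm.toLinearMap ε.symm.toLinearMap t, ?_⟩
    rw [← ht, ← LinearMap.comp_apply, ← TensorProduct.map_comp]
    congr 2 <;> ext <;> simp [e]
  have hsup : ⨆ p : ULift.{u} (Fin S.card) × ULift.{u} (Fin S.card),
      X.restrictComponent e c p.1 p.2 = ⊤ := by
    refine eq_top_iff.2 fun v _ => ?_
    have hle : D ≤ (⨆ p : ULift.{u} (Fin S.card) × ULift.{u} (Fin S.card),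
        X.restrictComponent e c p.1 p.2).map e := by
      conv_lhs => rw [← hB]
      refine Submodule.span_le.2 fun x hx => ?_
      have hxD : x ∈ D := hB ▸ Submodule.subset_span hx
      rw [← hF x (F x) subset_rfl]
      refine Submodule.sum_mem _ fun p hp => ?_
      obtain ⟨i, hi⟩ := hcS _ (hFS x hx p hp).1
      obtain ⟨i', hi'⟩ := hcS _ (hFS x hx p hp).2
      have hpD : X.proj p x ∈ LinearMap.range e := hrange.symm ▸ hDp p x hxD
      obtain ⟨w, hw⟩ := hpD
      refine ⟨w, Submodule.mem_iSup_of_mem (i, i') ?_, hw⟩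
      change e w ∈ X.component (c i) (c i')
      rw [hw, hi, hi']
      exact X.proj_mem p x
    obtain ⟨w, hw, hwv⟩ := hle (ε v).2
    rwa [← he hwv]
  let R := restrict he hc hcomul hsup
  refine ⟨{ dim := Module.finrank k D
            numColors := S.card
            component := R.component
            iSupIndep_component := R.iSupIndep_component
            iSup_component := R.iSup_component
            comul := R.comul
            coassoc := R.coassoc
            comul_mem := R.comul_mem
            conilpotent := R.conilpotent }, restrictHom he hc hcomul hsup, he, hc,
    hWD.trans hrange.ge, fun g hg => hcS g (hTS hg)⟩

/-- A family of maps `Hom(A, X) → Hom(A, Y)`, natural in the finite model `A`, is given by a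
morphism `X ⟶ Y`, because `X` is the directed union of its finite subobjects. -/
lemma exists_hom_of_natural (τ : ∀ A : FiniteModel k, (A.obj ⟶ X) → (A.obj ⟶ Y))
    (hτ : ∀ (A B : FiniteModel k) (v : A.obj ⟶ B.obj) (u : B.obj ⟶ X),
      τ A (v ≫ u) = v ≫ τ B u) : ∃ f : X ⟶ Y, ∀ A (u : A.obj ⟶ X), u ≫ f = τ A u := by
  -- any two morphisms from finite models to `X` factor through a third one, which is injective
  have hcommon : ∀ {A B : FiniteModel k} (u : A.obj ⟶ X) (u' : B.obj ⟶ X),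
      ∃ (E : FiniteModel k) (j : E.obj ⟶ X) (v : A.obj ⟶ E.obj) (v' : B.obj ⟶ E.obj),
        Function.Injective (Hom.toLinearMap j) ∧ Function.Injective (Hom.onColors j) ∧
          v ≫ j = u ∧ v' ≫ j = u' := by
    intro A B u u'
    obtain ⟨E, j, hj, hj', hW, hT⟩ := X.exists_finiteModel
      (LinearMap.range (Hom.toLinearMap u) ⊔ LinearMap.range (Hom.toLinearMap u'))
      (Set.range (Hom.onColors u) ∪ Set.range (Hom.onColors u'))
      ((Set.finite_range _).union (Set.finite_range _))
    obtain ⟨v, hv⟩ := Hom.exists_factorization j hj hj' u (le_sup_left.trans hW)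
      (Set.subset_union_left.trans hT)
    obtain ⟨v', hv'⟩ := Hom.exists_factorization j hj hj' u' (le_sup_right.trans hW)
      (Set.subset_union_right.trans hT)
    exact ⟨E, j, v, v', hj, hj', hv, hv'⟩
  have hwd : ∀ {A B : FiniteModel k} (u : A.obj ⟶ X) (u' : B.obj ⟶ X) z z',
      Hom.toLinearMap u z = Hom.toLinearMap u' z' →
        Hom.toLinearMap (τ A u) z = Hom.toLinearMap (τ B u') z' := by
    intro A B u u' z z' h
    obtain ⟨E, j, v, v', hj, -, rfl, rfl⟩ := hcommon u u'
    rw [hτ, hτ]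
    exact congrArg (Hom.toLinearMap (τ E j)) (hj h)
  have hwd' : ∀ {A B : FiniteModel k} (u : A.obj ⟶ X) (u' : B.obj ⟶ X) g g',
      Hom.onColors u g = Hom.onColors u' g' →
        Hom.onColors (τ A u) g = Hom.onColors (τ B u') g' := by
    intro A B u u' g g' h
    obtain ⟨E, j, v, v', -, hj, rfl, rfl⟩ := hcommon u u'
    rw [hτ, hτ]
    exact congrArg (Hom.onColors (τ E j)) (hj h)
  have hcover : ∀ (x y : X.carrier) (g h : X.colors), ∃ (A : FiniteModel k) (j : A.obj ⟶ X),
      Function.Injective (Hom.toLinearMap j) ∧ Function.Injective (Hom.onColors j) ∧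
      (∃ z, Hom.toLinearMap j z = x) ∧ (∃ z, Hom.toLinearMap j z = y) ∧
      (∃ a, Hom.onColors j a = g) ∧ ∃ a, Hom.onColors j a = h := by
    intro x y g h
    obtain ⟨A, j, hj, hj', hW, hT⟩ := X.exists_finiteModel (k ∙ x ⊔ k ∙ y) {g, h}
      (Set.toFinite _)
    exact ⟨A, j, hj, hj', hW (le_sup_left (a := k ∙ x) (Submodule.mem_span_singleton_self x)),
      hW (le_sup_right (b := k ∙ y) (Submodule.mem_span_singleton_self y)),
      hT (by simp), hT (by simp)⟩
  have hcover' : ∀ x y : X.carrier, ∃ (A : FiniteModel k) (j : A.obj ⟶ X) (z w : A.obj.carrier),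
      Hom.toLinearMap j z = x ∧ Hom.toLinearMap j w = y := by
    intro x y
    obtain ⟨A, j, -, -, hW, -⟩ := X.exists_finiteModel (k ∙ x ⊔ k ∙ y) ∅ Set.finite_empty
    obtain ⟨z, hz⟩ := hW (le_sup_left (a := k ∙ x) (Submodule.mem_span_singleton_self x))
    obtain ⟨w, hw⟩ := hW (le_sup_right (b := k ∙ y) (Submodule.mem_span_singleton_self y))
    exact ⟨A, j, z, w, hz, hw⟩
  choose A j z hz using fun x => (hcover' x x).imp fun A h => h.imp fun j h => h.imp
    fun z h => h.choose_spec.1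
  have hf : ∀ (B : FiniteModel k) (u : B.obj ⟶ X) w,
      Hom.toLinearMap (τ _ (j (Hom.toLinearMap u w))) (z (Hom.toLinearMap u w)) =
        Hom.toLinearMap (τ B u) w := fun B u w => hwd _ _ _ _ (hz _)
  choose A' j' a ha using fun g => (hcover 0 0 g g).imp fun A h => h.imp
    fun j h => h.2.2.2.2.1
  have hi : ∀ (B : FiniteModel k) (u : B.obj ⟶ X) b,
      Hom.onColors (τ _ (j' (Hom.onColors u b))) (a (Hom.onColors u b)) =
        Hom.onColors (τ B u) b := fun B u w => hwd' _ _ _ _ (ha _)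
  let f : X.carrier →ₗ[k] Y.carrier :=
    { toFun := fun x => Hom.toLinearMap (τ _ (j x)) (z x)
      map_add' := fun x y => by
        obtain ⟨B, u, v, w, rfl, rfl⟩ := hcover' x y
        rw [← map_add, hf, hf, hf, map_add]
      map_smul' := fun c x => by
        obtain ⟨B, u, v, -, rfl, -⟩ := hcover' x x
        rw [← map_smul, hf, hf, map_smul]
        rfl }
  have hf' : ∀ (B : FiniteModel k) (u : B.obj ⟶ X) w,
      f (Hom.toLinearMap u w) = Hom.toLinearMap (τ B u) w := hf
  have hfu : ∀ (B : FiniteModel k) (u : B.obj ⟶ X),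
      f ∘ₗ Hom.toLinearMap u = Hom.toLinearMap (τ B u) := fun B u => LinearMap.ext (hf' B u)
  refine ⟨{ toLinearMap := f
            onColors := fun g => Hom.onColors (τ _ (j' g)) (a g)
            map_mem := fun g h x hx => ?_
            map_comul := ?_ }, fun B u => Hom.ext (hfu B u) (funext (hi B u))⟩
  · obtain ⟨B, u, hu, hu', ⟨w, rfl⟩, -, ⟨b, rfl⟩, ⟨b', rfl⟩⟩ := hcover x x g h
    rw [hf', hi, hi]
    exact Hom.map_mem _ _ _ _ (Hom.mem_component_of_injective u hu hu' hx)
  · ext x : 1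
    obtain ⟨B, u, v, -, rfl, -⟩ := hcover' x x
    rw [LinearMap.comp_apply, LinearMap.comp_apply, hf', Hom.comul_apply u,
      ← LinearMap.comp_apply (TensorProduct.map f f), ← TensorProduct.map_comp, hfu,
      Hom.comul_apply (τ B u)]

lemma hom_ext_finiteModel {f g : X ⟶ Y} (h : ∀ (A : FiniteModel k) (u : A.obj ⟶ X),
    u ≫ f = u ≫ g) : f = g := by
  refine Hom.ext (LinearMap.ext fun x => ?_) (funext fun s => ?_)
  · obtain ⟨A, j, -, -, hW, -⟩ := X.exists_finiteModel (k ∙ x) ∅ Set.finite_empty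
    obtain ⟨z, hz⟩ := hW (Submodule.mem_span_singleton_self x)
    rw [← hz]
    exact LinearMap.congr_fun (congrArg Hom.toLinearMap (h A j)) z
  · obtain ⟨A, j, -, -, -, hT⟩ := X.exists_finiteModel ⊥ {s} (Set.finite_singleton s)
    obtain ⟨a, ha⟩ := hT rfl
    rw [← ha]
    exact congrFun (congrArg Hom.onColors (h A j)) a

/-! ### Limits of reduced colored coalgebras -/

instance : SmallCategory (FiniteModel k) :=
  inferInstanceAs (Category (InducedCategory (ReducedColoredCoalg k) FiniteModel.obj))

variable (k) in
/-- The inclusion of the finite models into all reduced colored coalgebras. -/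
def finiteModelFunctor : FiniteModel k ⥤ ReducedColoredCoalg k :=
  inducedFunctor FiniteModel.obj

variable (k) in
/-- The functor that sends a reduced colored coalgebra `X` to the presheaf `A ↦ Hom(A, X)` on the
category of finite models. -/
noncomputable abbrev modelPoints : ReducedColoredCoalg k ⥤ (FiniteModel k)ᵒᵖ ⥤ Type u :=
  Presheaf.restrictedULiftYoneda.{u} (finiteModelFunctor k)

/-- A morphism from a finite model, as an element of the presheaf of points. -/
def toPoint {A : FiniteModel k} (u : A.obj ⟶ X) : ((modelPoints k).obj X).obj (Opposite.op A) :=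
  ULift.up u

/-- An element of the presheaf of points, as a morphism from a finite model. -/
def ofPoint {A : FiniteModel k} (p : ((modelPoints k).obj X).obj (Opposite.op A)) : A.obj ⟶ X :=
  ULift.down p

lemma map_toPoint {A B : FiniteModel k} (v : A.obj ⟶ B.obj) (u : B.obj ⟶ X) :
    ((modelPoints k).obj X).map (Quiver.Hom.op (InducedCategory.homMk v : A ⟶ B)) (toPoint u) =
      toPoint (v ≫ u) := rfl

lemma ofPoint_map {A B : FiniteModel k} (v : A.obj ⟶ B.obj)
    (p : ((modelPoints k).obj X).obj (Opposite.op B)) :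
    ofPoint (((modelPoints k).obj X).map
      (Quiver.Hom.op (InducedCategory.homMk v : A ⟶ B)) p) = v ≫ ofPoint p := rfl

instance : (modelPoints k).Faithful where
  map_injective {X Y f g} h := hom_ext_finiteModel fun A u =>
    congrArg (fun T => ofPoint (T.app (Opposite.op A) (toPoint u))) h

instance : (modelPoints k).Full where
  map_surjective {X Y} T := by
    obtain ⟨f, hf⟩ := exists_hom_of_natural (X := X) (Y := Y)
      (fun A u => ofPoint (T.app (Opposite.op A) (toPoint u))) fun A B v u => by
        rw [← ofPoint_map, ← map_toPoint]
        exact congrArg ofPoint (NatTrans.naturality_apply T _ (toPoint u))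
    refine ⟨f, ?_⟩
    ext ⟨A⟩ p
    exact congrArg toPoint (hf A (ofPoint p))

/-- The left adjoint of `modelPoints` is the extension of the inclusion of the finite models that
preserves colimits. -/
noncomputable instance : Reflective (modelPoints k) where
  L := (uliftYoneda.{u} : FiniteModel k ⥤ _).leftKanExtension (finiteModelFunctor k)
  adj := Presheaf.uliftYonedaAdjunction _
    ((uliftYoneda.{u} : FiniteModel k ⥤ _).leftKanExtensionUnit (finiteModelFunctor k))

instance : HasLimits (ReducedColoredCoalg k) := hasLimits_of_reflective (modelPoints k)

end ReducedColoredCoalg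

/-! ### Limits and colimits of pointed coalgebras with a splitting -/

theorem mainTheorem3 (k : Type u) [Field k] :
    (HasLimits (PointedSplitCoalg k) ∧ HasColimits (PointedSplitCoalg k)) ∧
    (HasLimits (ReducedColoredCoalg k) ∧ HasColimits (ReducedColoredCoalg k)) ∧
    Nonempty (PointedSplitCoalg k ≌ ReducedColoredCoalg k) := by
  let e := (ReducedColoredCoalg.totalFunctor k).asEquivalence
  exact ⟨⟨Adjunction.has_limits_of_equivalence e.inverse,
    Adjunction.has_colimits_of_equivalence e.inverse⟩, ⟨inferInstance, inferInstance⟩, ⟨e.symm⟩⟩
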